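/- Let $(\mathcal V,\mathcal E)$ be a finite directed multigraph with a source $s$ that has no incoming edge, and let $R\subset\mathcal V\setminus\{s\}$ be a set of $d\ge 1$ sinks such that every edge cut separating $s$ from a sink has at least $m\ge 1$ edges. Let $\mathbb F_q$ be a finite field. A convolutional code consists of local encoding kernels $k_{e',e}(z)=\sum_t k_{e',e,t}z^t$ for the adjacent pairs $(e',e)$ (the head of $e'$ is the tail of $e$) and vectors $f_e(z)\in\mathbb F_q[z]^m$ for the edges $e$ leaving $s$. The other global encoding kernels are given by $f_e(z)=\sum_{e'}k_{e',e}(z)f_{e'}(z)$, the sum being over the edges $e'$ that enter the tail of $e$, and $F_v(z)=\sum_t F_{v,t}z^t$ is the matrix with columns $f_e(z)$, $e$ entering $v$. Fix a set $D$ of adjacent pairs such that every directed cycle of edges uses some pair of $D$ ($D=\emptyset$ is allowed exactly in acyclic networks). ARCNC runs as follows. All kernels start at $0$. At time $t=0,1,2,\dots$ the coefficients of $z^t$ of all kernels $k_{e',e}(z)$ and of all entries of the $f_e(z)$, $e$ leaving $s$, are drawn independently and uniformly from $\mathbb F_q$, except that $k_{e',e,0}=0$ for $(e',e)\in D$, and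 that a node uses the coefficient $0$ from the time after that at which all sinks downstream of it have acknowledged. A sink $r$ acknowledges at its first decoding time $T_r$, the first time at which, for the code in force at that time, it passes the decodability test. The test at time $t$ is one of the following: (i) $\operatorname{rank}M_{r,t}-\operatorname{rank}M_{r,t-1}=m$, where $M_{r,i}$ is the block upper triangular Toeplitz matrix with first block row $(F_{r,0},\dots,F_{r,i})$ and $M_{r,-1}$ is the empty matrix; (ii) $F_r(z)$ has rank $m$ (over the field of fractions of $\mathbb F_q[[z]]$). Put $T_N=\max_{r\in R}T_r$, and let $\eta$ be the number of edges $e$ that carry a random coefficient, i.e. that leave $s$ or are the second edge of an adjacent pair. (a) With either test, for every $0<\varepsilon<1$ there is an integer $T_0>0$ such that $P(T_N>t)<\varepsilon$ for all integers $t\ge T_0$. (b) With either test, ARCNC terminates in finite time with probability $1$: almost surely $T_N<\infty$, and from some time on the kernels no longer change. (c) With test (ii), for every $0<\varepsilon<1$ put $$T_0=\left\lceil\log_q d-\log_q\bigl(1-(1-\varepsilon)^{1/\eta}\bigr)\right\rceil-1 .$$ If $D=\emptyset$, then $P(T_N>t)\le\varepsilon$ for all integers $t\ge T_0$, and $P(T_N>t)<\varepsilon$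 if moreover $t>T_0$ or $\log_q d-\log_q(1-(1-\varepsilon)^{1/\eta})$ is not an integer. For arbitrary $D$ the same holds with $T_0$ replaced by $T_0+1$. -/

import Mathlib

open MeasureTheory ProbabilityTheory PowerSeries
open scoped ENNReal

noncomputable section

namespace ARCNC

/-- A single-source network: a directed multigraph with node set `V` and edge set `E`; the edge `e`
goes from `tail e` to `head e`, and the source has no incoming edge. -/
structure Network (V E : Type*) where
  tail : E → V
  head : E → V
  source : V
  no_in : ∀ e, head e ≠ source

variable {V E F : Type*} {m : ℕ}

/-- Adjacent pairs of edges `(e', e)`: the edge `e` leaves the node that `e'` enters. -/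
abbrev Network.AdjPair (N : Network V E) : Type _ :=
  {p : E × E // N.head p.1 = N.tail p.2}

/-- The places of a code that carry an encoding kernel: one local encoding kernel `k_{e',e}(z)` for
each adjacent pair, and the `m` entries of `f_e(z)` for each edge `e` leaving the source. -/
abbrev Network.Coef (N : Network V E) (m : ℕ) : Type _ :=
  N.AdjPair ⊕ ({e : E // N.tail e = N.source} × Fin m)

/-- The edge (link) on which a kernel is used. -/
def Network.link (N : Network V E) : N.Coef m → E
  | Sum.inl p => p.1.2
  | Sum.inr p => p.1.1

/-- `η`: the number of links with random coefficients. -/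
def Network.numRandomLinks (N : Network V E) (m : ℕ) : ℕ :=
  (Set.range (N.link (m := m))).ncard

/-- `w` is downstream of `v`: there is a directed path with at least one edge from `v` to `w`. -/
def Network.Downstream (N : Network V E) : V → V → Prop :=
  Relation.TransGen fun v w => ∃ e, N.tail e = v ∧ N.head e = w

/-- Every edge cut that separates the source from `r` has at least `m` edges. -/
def Network.MinCutAtLeast [Finite E] (N : Network V E) (m : ℕ) (r : V) : Prop :=
  ∀ S : Set V, N.source ∈ S → r ∉ S → m ≤ {e : E | N.tail e ∈ S ∧ N.head e ∉ S}.ncard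

/-- `D` is the set of adjacent pairs `(e', e)` for which `k_{e',e,0}` is set to `0`. It is
admissible if every directed cycle of edges passes through some pair of `D`. -/
def Network.Admissible (N : Network V E) (D : Set N.AdjPair) : Prop :=
  ∀ e, ¬ Relation.TransGen
    (fun e' e => ∃ h : N.head e' = N.tail e, (⟨(e', e), h⟩ : N.AdjPair) ∉ D) e e

section Code

variable [Field F]

open Classical in
/-- The matrix `(k_{e',e}(z))`, with entry `0` at pairs that are not adjacent. -/
def localMatrix (N : Network V E) (κ : N.Coef m → F⟦X⟧) : Matrix E E F⟦X⟧ :=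
  fun e' e => if h : N.head e' = N.tail e then κ (Sum.inl ⟨(e', e), h⟩) else 0

open Classical in
/-- The matrix whose columns are `f_e(z)` for the edges `e` leaving the source, and `0` for the
other edges. -/
def sourceMatrix (N : Network V E) (κ : N.Coef m → F⟦X⟧) : Matrix (Fin m) E F⟦X⟧ :=
  fun i e => if h : N.tail e = N.source then κ (Sum.inr (⟨e, h⟩, i)) else 0

open Classical in
/-- The global encoding kernels: column `e` is `f_e(z)`. This is the unique solution of
`f_e(z) = ∑ k_{e',e}(z) f_{e'}(z)` (`e` not leaving the source) with the given `f_e(z)` at the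
source, see `globalMatrix_unique`. -/
def globalMatrix [Fintype E] (N : Network V E) (κ : N.Coef m → F⟦X⟧) : Matrix (Fin m) E F⟦X⟧ :=
  sourceMatrix N κ * (1 - localMatrix N κ)⁻¹

open Classical in
theorem isUnit_one_sub_localMatrix [Fintype E] (N : Network V E) (D : Set N.AdjPair)
    (hD : N.Admissible D) (κ : N.Coef m → F⟦X⟧)
    (hκ : ∀ p ∈ D, constantCoeff (κ (Sum.inl p)) = 0) :
    IsUnit (1 - localMatrix N κ).det := by
  rw [PowerSeries.isUnit_iff_constantCoeff, RingHom.map_det, isUnit_iff_ne_zero]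
  intro h0
  obtain ⟨v, hv0, hv⟩ := Matrix.exists_vecMul_eq_zero_iff.mpr h0
  apply hv0
  let r : E → E → Prop :=
    fun e' e => ∃ h : N.head e' = N.tail e, (⟨(e', e), h⟩ : N.AdjPair) ∉ D
  have hwf : WellFounded (Relation.TransGen r) := by
    have : Std.Irrefl (Relation.TransGen r) := ⟨hD⟩
    exact Finite.wellFounded_of_trans_of_irrefl _
  funext e
  induction e using hwf.induction with
  | _ e ih =>
    have he := congrFun hv e
    rw [map_sub, map_one, Matrix.vecMul_sub, Matrix.vecMul_one] at he
    have hz : Matrix.vecMul v ((constantCoeff (R := F)).mapMatrix (localMatrix N κ)) e = 0 := by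
      apply Finset.sum_eq_zero
      intro e' _
      by_cases h : N.head e' = N.tail e
      · by_cases hd : (⟨(e', e), h⟩ : N.AdjPair) ∈ D
        · simp [localMatrix, h, hκ _ hd]
        · simp [ih e' (Relation.TransGen.single ⟨h, hd⟩)]
      · simp [localMatrix, h]
    rw [Pi.sub_apply, hz, sub_zero] at he
    exact he

/-- The global encoding kernels are the unique solution of the encoding equations. -/
theorem globalMatrix_unique [Fintype E] (N : Network V E) (D : Set N.AdjPair)
    (hD : N.Admissible D) (κ : N.Coef m → F⟦X⟧)
    (hκ : ∀ p ∈ D, constantCoeff (κ (Sum.inl p)) = 0) (G : Matrix (Fin m) E F⟦X⟧) :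
    G = globalMatrix N κ ↔
      ∀ i e, G i e = sourceMatrix N κ i e + ∑ e', G i e' * localMatrix N κ e' e := by
  classical
  have hu := isUnit_one_sub_localMatrix N D hD κ hκ
  have key : (∀ i e, G i e = sourceMatrix N κ i e + ∑ e', G i e' * localMatrix N κ e' e) ↔
      G * (1 - localMatrix N κ) = sourceMatrix N κ := by
    rw [Matrix.mul_sub, Matrix.mul_one, sub_eq_iff_eq_add, ← Matrix.ext_iff]
    simp [Matrix.mul_apply]
  rw [key]
  have hgl : globalMatrix N κ = sourceMatrix N κ * (1 - localMatrix N κ)⁻¹ := by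
    unfold globalMatrix
    congr!
  rw [hgl]
  constructor
  · rintro rfl
    rw [Matrix.mul_assoc, Matrix.nonsing_inv_mul _ hu, Matrix.mul_one]
  · intro h
    rw [← h, Matrix.mul_assoc, Matrix.mul_nonsing_inv _ hu, Matrix.mul_one]

/-- `F_v(z)`: the global encoding kernel matrix at the node `v`. -/
def nodeMatrix [Fintype E] (N : Network V E) (κ : N.Coef m → F⟦X⟧) (v : V) :
    Matrix (Fin m) {e : E // N.head e = v} F⟦X⟧ :=
  fun i e => globalMatrix N κ i e.1

/-- The block upper triangular Toeplitz matrix with `n` block rows and block columns, whose block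
`(a, b)` is `F_{v,b-a}` for `a ≤ b` and `0` otherwise; it is `M_{v,n-1}`. -/
def toeplitz [Fintype E] (N : Network V E) (κ : N.Coef m → F⟦X⟧) (v : V) (n : ℕ) :
    Matrix (Fin n × Fin m) (Fin n × {e : E // N.head e = v}) F :=
  fun a b => if a.1 ≤ b.1 then coeff ((b.1 : ℕ) - (a.1 : ℕ)) (nodeMatrix N κ v a.2 b.2) else 0

open Classical in
/-- The decodability condition `rank M_{r,t} - rank M_{r,t-1} = m` at time `t`, where `M_{r,-1}` is
the empty matrix. -/
def toeplitzTest [Fintype E] (N : Network V E) (κ : N.Coef m → F⟦X⟧) (t : ℕ) (r : V) : Prop :=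
  (toeplitz N κ r (t + 1)).rank = (toeplitz N κ r t).rank + m

open Classical in
/-- Decodability at `r` as the condition that `F_r(z)` has full rank `m` (over the field of
fractions), for the code in force at the time of the test. -/
def fullRankTest [Fintype E] (N : Network V E) (κ : N.Coef m → F⟦X⟧) (_t : ℕ) (r : V) : Prop :=
  ((nodeMatrix N κ r).map (algebraMap F⟦X⟧ (FractionRing F⟦X⟧))).rank = m

/-- The state of the algorithm: all kernels (with the coefficients chosen so far, the others being
`0`) and the set of sinks that have acknowledged. -/
structure State (N : Network V E) (F : Type*) (m : ℕ) where
  kernel : N.Coef m → F⟦X⟧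
  acked : Set V

/-- A node has stopped when all sinks downstream of it have acknowledged. -/
def Stopped (N : Network V E) (R : Finset V) (acked : Set V) (v : V) : Prop :=
  ∀ r ∈ R, N.Downstream v r → r ∈ acked

open Classical in
/-- The algorithm ARCNC with sinks `R`, delayed pairs `D`, and a decodability test, run on the
coefficients `x`: `x (c, t)` is the coefficient drawn for the kernel `c` at time `t`. At time `t`
each node which had not stopped at time `t - 1` uses the coefficients drawn at time `t` as the
coefficients of `z ^ t` of its kernels; a stopped node uses `0`. Then each sink performs the test
and acknowledges at once if the test is positive. -/
def run (N : Network V E) (R : Finset V) (D : Set N.AdjPair)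
    (test : (N.Coef m → F⟦X⟧) → ℕ → V → Prop) (x : N.Coef m × ℕ → F) : ℕ → State N F m
  | 0 =>
    let κ : N.Coef m → F⟦X⟧ := fun c =>
      monomial 0 (if ∃ p ∈ D, c = Sum.inl p then 0 else x (c, 0))
    ⟨κ, {r | r ∈ R ∧ test κ 0 r}⟩
  | t + 1 =>
    let S := run N R D test x t
    let κ : N.Coef m → F⟦X⟧ := fun c =>
      S.kernel c +
        monomial (t + 1) (if Stopped N R S.acked (N.tail (N.link c)) then 0 else x (c, t + 1))
    ⟨κ, S.acked ∪ {r | r ∈ R ∧ test κ (t + 1) r}⟩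

/-- The first decoding time `T_r`. -/
def firstDecodingTime (N : Network V E) (R : Finset V) (D : Set N.AdjPair)
    (test : (N.Coef m → F⟦X⟧) → ℕ → V → Prop) (x : N.Coef m × ℕ → F) (r : V) : ℕ∞ :=
  ⨅ t ∈ {t : ℕ | test (run N R D test x t).kernel t r}, (t : ℕ∞)

/-- `T_N`, the maximum of the first decoding times of the sinks. -/
def networkTime (N : Network V E) (R : Finset V) (D : Set N.AdjPair)
    (test : (N.Coef m → F⟦X⟧) → ℕ → V → Prop) (x : N.Coef m × ℕ → F) : ℕ∞ :=
  R.sup (firstDecodingTime N R D test x)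

/-- Along every run the kernels respect the delayed pairs, so that the global encoding kernels are
always determined by the encoding equations. -/
theorem constantCoeff_run (N : Network V E) (R : Finset V) (D : Set N.AdjPair)
    (test : (N.Coef m → F⟦X⟧) → ℕ → V → Prop) (x : N.Coef m × ℕ → F) (t : ℕ) :
    ∀ p ∈ D, constantCoeff ((run N R D test x t).kernel (Sum.inl p)) = 0 := by
  intro p hp
  induction t with
  | zero => simp [run, hp]
  | succ t ih =>
    simp only [run, map_add, ih, zero_add]
    rw [← coeff_zero_eq_constantCoeff_apply, coeff_monomial, if_neg (by omega)]

end Code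

/-- `log_q d - log_q (1 - (1 - ε)^{1/η})`. -/
def logTerm (q d η : ℕ) (ε : ℝ) : ℝ :=
  Real.logb q d - Real.logb q (1 - (1 - ε) ^ (1 / (η : ℝ)))

/-- The explicit time `T₀ = ⌈log_q d - log_q (1 - (1 - ε)^{1/η})⌉ - 1`. -/
def explicitTime (q d η : ℕ) (ε : ℝ) : ℤ :=
  ⌈logTerm q d η ε⌉ - 1

end ARCNC

end

namespace ARCNC

/-! A sink's decodability is read off one determinant. For a decoding matrix `B` supported on the
edges entering `r`, the Edmonds matrix with blocks `1 - K`, `B`, `A`, `0` (`K` local kernels, `A`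
source kernels) has, by the Schur complement, determinant equal to a multiple of `det (F_r B)`. If
it is nonzero, `F_r` has rank `m`; if `X ^ (t + 1)` does not divide it, the Toeplitz test succeeds
at time `t`. Hall's theorem and the cut condition give a perfect matching in the support of this
matrix, hence kernels and a `B` with nonzero determinant (`exists_det_edmondsMatrix_ne_zero`).

The kernels of one link sit in one column, so the determinant is affine in them. Expose the links
one at a time, as in the Schwartz-Zippel argument: if each sink's determinant can still be made to
avoid an ideal `I n`, then after the next link it can still be made to avoid `I (n + 1)`, except for
a fraction at most `d / Q` of the samples. After `η` links a fraction at least `(1 - d / Q) ^ η` is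
good (`pow_mul_card_le_card_notMem`). For the rank test all ideals are `⊥`, and `Q` is `q ^ (t + 1)`
without delays, `q ^ t` in general. For arbitrary tests the ideals are generated by powers of `X`,
with `l` further powers given up per link in exchange for `Q = q ^ l`.

Stopping does no harm: until `r` acknowledges, no node upstream of it has stopped, so `F_r` is that
of the code made of all coefficients drawn so far (`firstDecodingTime_le_of_test_truncKernel`). It
therefore suffices to bound, at a single time, the chance that this truncated random code fails.
Almost sure termination follows because these bounds tend to `0`. -/

/-- Double counting along an involution of `α × γ`. -/
theorem sum_card_filter_eq {α γ : Type*} [DecidableEq α] [Fintype γ] (φ : α → γ → α)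
    (ψ : α → γ → γ) (hφ : ∀ x u, φ (φ x u) (ψ x u) = x) (hψ : ∀ x u, ψ (φ x u) (ψ x u) = u)
    (A B : Finset α) (hA : ∀ x ∈ A, ∀ u, φ x u ∈ A) (hB : B ⊆ A) :
    ∑ x ∈ A, (Finset.univ.filter fun u => φ x u ∈ B).card = B.card * Fintype.card γ := by
  classical
  have h1 : ∑ x ∈ A, (Finset.univ.filter fun u => φ x u ∈ B).card
      = ((A ×ˢ (Finset.univ : Finset γ)).filter fun p => φ p.1 p.2 ∈ B).card := by
    simp only [Finset.card_filter, Finset.sum_product]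
  rw [h1, ← Finset.card_univ, ← Finset.card_product]
  refine Finset.card_bij' (fun p _ => (φ p.1 p.2, ψ p.1 p.2)) (fun p _ => (φ p.1 p.2, ψ p.1 p.2))
    ?_ ?_ ?_ ?_
  · rintro ⟨x, u⟩ h
    simpa using (Finset.mem_filter.mp h).2
  · rintro ⟨x, u⟩ h
    have hx : x ∈ B := by simpa using h
    simp [hφ, hx, hA x (hB hx) u]
  · rintro ⟨x, u⟩ _
    simp [hφ, hψ]
  · rintro ⟨x, u⟩ _
    simp [hφ, hψ]

/-- A function of the kernels is affine on every link if it is an affine function of the kernels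
used on that link as long as the other kernels are fixed. -/
def LinkAffine {C E R : Type*} [CommRing R] (link : C → E) (g : (C → R) → R) : Prop :=
  ∀ (e : E) (κ : C → R), ∃ (a₀ : R) (L : (C → R) →ₗ[R] R),
    ∀ κ', (∀ c, link c ≠ e → κ' c = κ c) → g κ' = a₀ + L κ'

/-! ### Exposing random kernels link by link -/

section Counting

variable {C E R β : Type*} [Fintype C] [DecidableEq E] [CommRing R] [Fintype β]

open Classical in
/-- An affine function with a value outside `I` falls into `J` with frequency at most `1 / Q`. -/
theorem card_affine_mem_mul_le (link : C → E) (Y : C → β → R) (I J : Ideal R) (hJ : J ≤ I) (Q : ℕ)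
    (hY : ∀ c a₀ a, a ∉ I →
      (Finset.univ.filter fun b => a₀ + a * Y c b ∈ J).card * Q ≤ Fintype.card β)
    (g : (C → R) → R) (hg : LinkAffine link g) (e : E) (κ : C → R) (hκ : g κ ∉ I) :
    (Finset.univ.filter fun u : C → β =>
      g (fun c => if link c = e then Y c (u c) else κ c) ∈ J).card * Q
        ≤ Fintype.card (C → β) := by
  obtain ⟨a₀, L, hL⟩ := hg e κ
  -- Either some slope on this link lies outside `I`, and resampling that one kernel gives the
  -- bound, or all slopes lie in `I`; then `g` is constant modulo `I` along the link and never
  -- enters `J ≤ I`.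
  by_cases h : ∃ c, link c = e ∧ L (Pi.single c 1) ∉ I
  · obtain ⟨c, hc, ha⟩ := h
    rcases isEmpty_or_nonempty (C → β) with hE | ⟨⟨u₀⟩⟩
    · simp
    have hβ : 0 < Fintype.card β := Fintype.card_pos_iff.mpr ⟨u₀ c⟩
    set B := Finset.univ.filter fun u : C → β =>
      g (fun c => if link c = e then Y c (u c) else κ c) ∈ J with hB
    have key := sum_card_filter_eq (fun (x : C → β) b => Function.update x c b) (fun x _ => x c)
      (by simp) (by simp) Finset.univ B (by simp) (Finset.subset_univ _)
    have hle : ∀ x : C → β,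
        (Finset.univ.filter fun b => Function.update x c b ∈ B).card * Q ≤ Fintype.card β := by
      intro x
      set κ' : C → R := fun c => if link c = e then Y c (x c) else κ c
      refine le_trans (Nat.mul_le_mul_right _ (Finset.card_le_card ?_))
        (hY c (a₀ + L (Function.update κ' c 0)) _ ha)
      intro b hb
      simp only [hB, Finset.mem_filter, Finset.mem_univ, true_and] at hb ⊢
      have h1 : (fun c' => if link c' = e then Y c' (Function.update x c b c') else κ c')
          = Function.update κ' c (Y c b) := by
        funext c'
        by_cases hcc : c' = c
        · subst hcc; simp [hc]
        · simp [hcc, κ']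
      rw [h1, hL] at hb
      · have h2 : Function.update κ' c (Y c b)
            = Function.update κ' c 0 + (Y c b) • (Pi.single c 1 : C → R) := by
          funext c'
          by_cases hcc : c' = c
          · subst hcc; simp
          · simp [hcc]
        rw [h2, map_add, map_smul, smul_eq_mul, mul_comm, ← add_assoc] at hb
        exact hb
      · intro c' hc'
        have : c' ≠ c := by rintro rfl; exact hc' hc
        simp [this, κ', hc']
    have hsum : (∑ x : C → β, (Finset.univ.filter fun b => Function.update x c b ∈ B).card) * Q
        ≤ Fintype.card (C → β) * Fintype.card β := by
      rw [Finset.sum_mul]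
      refine (Finset.sum_le_sum fun x _ => hle x).trans ?_
      simp
    rw [key] at hsum
    refine Nat.le_of_mul_le_mul_right ?_ hβ
    linarith [hsum, mul_right_comm B.card (Fintype.card β) Q]
  · push Not at h
    have : (Finset.univ.filter fun u : C → β =>
        g (fun c => if link c = e then Y c (u c) else κ c) ∈ J) = ∅ := by
      refine Finset.filter_eq_empty_iff.mpr fun u _ hu => hκ ?_
      rw [hL κ fun _ _ => rfl]
      rw [hL _ fun c hc => if_neg hc] at hu
      set κ' : C → R := fun c => if link c = e then Y c (u c) else κ c
      have hd : L (κ - κ') ∈ I := by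
        rw [LinearMap.pi_apply_eq_sum_univ L]
        refine Ideal.sum_mem _ fun c _ => ?_
        by_cases hc : link c = e
        · rw [smul_eq_mul]
          have hs : (fun j => if c = j then (1 : R) else 0) = Pi.single c 1 := by
            funext j; simp [Pi.single_apply, eq_comm]
          exact I.mul_mem_left _ (hs ▸ h c hc)
        · simp [κ', hc]
      have := I.add_mem (hJ hu) hd
      rwa [map_sub, add_assoc, add_sub_cancel] at this
    simp [this]

variable {ι : Type*}

open Classical in
/-- The samples for which, after the kernels on the links in `s` have been fixed, every `g r` can
still attain a value outside `I`. -/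
noncomputable def extendable (link : C → E) (Y : C → β → R) (S : Finset ι)
    (g : ι → (C → R) → R) (I : Ideal R) (s : Finset E) : Finset (C → β) :=
  Finset.univ.filter fun x =>
    ∀ r ∈ S, ∃ κ : C → R, (∀ c, link c ∈ s → κ c = Y c (x c)) ∧ g r κ ∉ I

-- Extendability over `s` ignores the kernels on `e ∉ s`, so these may be resampled independently.
-- For each `r` the resampled link spoils its witness with frequency at most `1 / Q`, and a union
-- bound over `S` costs `|S| / Q`.
open Classical in
theorem card_extendable_insert (link : C → E) (Y : C → β → R) (S : Finset ι)
    (g : ι → (C → R) → R) (hg : ∀ r ∈ S, LinkAffine link (g r)) (I J : Ideal R) (hJ : J ≤ I)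
    (Q : ℕ)
    (hY : ∀ c a₀ a, a ∉ I →
      (Finset.univ.filter fun b => a₀ + a * Y c b ∈ J).card * Q ≤ Fintype.card β)
    (s : Finset E) (e : E) (he : e ∉ s) :
    (extendable link Y S g I s).card * (Q - S.card)
      ≤ (extendable link Y S g J (insert e s)).card * Q := by
  rcases isEmpty_or_nonempty (C → β) with hE | ⟨⟨u₀⟩⟩
  · simp [Finset.eq_empty_of_isEmpty]
  set A := extendable link Y S g I s with hA
  set B := A \ extendable link Y S g J (insert e s) with hB
  let φ : (C → β) → (C → β) → C → β := fun x u c => if link c = e then u c else x c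
  have hφA : ∀ x ∈ A, ∀ u, φ x u ∈ A := by
    intro x hx u
    simp only [hA, extendable, Finset.mem_filter, Finset.mem_univ, true_and] at hx ⊢
    intro r hr
    obtain ⟨κ, h1, h2⟩ := hx r hr
    refine ⟨κ, fun c hc => ?_, h2⟩
    have : link c ≠ e := by rintro rfl; exact he hc
    simp [φ, this, h1 c hc]
  have key := sum_card_filter_eq φ (fun x u => φ u x)
    (by intro x u; funext c; simp only [φ]; split_ifs <;> rfl)
    (by intro x u; funext c; simp only [φ]; split_ifs <;> rfl) A B hφA Finset.sdiff_subset
  have hle : ∀ x ∈ A, (Finset.univ.filter fun u => φ x u ∈ B).card * Q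
      ≤ S.card * Fintype.card (C → β) := by
    intro x hx
    have hx' := hx
    simp only [hA, extendable, Finset.mem_filter, Finset.mem_univ, true_and] at hx'
    choose! κ h1 h2 using hx'
    -- The witness `κ r` stays free off `s`; writing the sampled kernels of `e` into it gives a
    -- candidate witness for `insert e s`. A bad sample makes this candidate fail for some `r`.
    have hsub : (Finset.univ.filter fun u => φ x u ∈ B) ⊆ S.biUnion fun r =>
        Finset.univ.filter fun u : C → β =>
          g r (fun c => if link c = e then Y c (u c) else κ r c) ∈ J := by
      intro u hu
      simp only [hB, Finset.mem_filter, Finset.mem_univ, true_and, Finset.mem_sdiff] at hu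
      by_contra hcon
      apply hu.2
      simp only [extendable, Finset.mem_filter, Finset.mem_univ, true_and]
      intro r hr
      refine ⟨fun c => if link c = e then Y c (u c) else κ r c, fun c hc => ?_, fun hmem =>
        hcon (Finset.mem_biUnion.mpr ⟨r, hr, by simpa using hmem⟩)⟩
      by_cases hce : link c = e
      · simp [φ, hce]
      · have hcs : link c ∈ s := (Finset.mem_insert.mp hc).resolve_left hce
        simp [φ, hce, h1 r hr c hcs]
    calc _ ≤ (∑ r ∈ S, (Finset.univ.filter fun u : C → β =>
          g r (fun c => if link c = e then Y c (u c) else κ r c) ∈ J).card) * Q :=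
          Nat.mul_le_mul_right _ ((Finset.card_le_card hsub).trans Finset.card_biUnion_le)
      _ ≤ ∑ r ∈ S, Fintype.card (C → β) := by
          rw [Finset.sum_mul]
          exact Finset.sum_le_sum fun r hr =>
            card_affine_mem_mul_le link Y I J hJ Q hY (g r) (hg r hr) e (κ r) (h2 r hr)
      _ = _ := by simp
  have hsum : B.card * Fintype.card (C → β) * Q ≤ A.card * (S.card * Fintype.card (C → β)) := by
    rw [← key, Finset.sum_mul, ← smul_eq_mul A.card, ← Finset.sum_const]
    exact Finset.sum_le_sum hle
  have hpos : 0 < Fintype.card (C → β) := Fintype.card_pos_iff.mpr ⟨u₀⟩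
  have hBA : B.card * Q ≤ A.card * S.card := by
    refine Nat.le_of_mul_le_mul_right ?_ hpos
    linarith [hsum, mul_right_comm B.card (Fintype.card (C → β)) Q,
      mul_assoc A.card S.card (Fintype.card (C → β))]
  have hAle : A.card ≤ B.card + (extendable link Y S g J (insert e s)).card := by
    rw [hB]
    have := Finset.card_le_card_sdiff_add_card (s := A) (t := extendable link Y S g J (insert e s))
    omega
  rw [Nat.mul_sub]
  have := Nat.mul_le_mul_right Q hAle
  rw [add_mul] at this
  omega

open Classical in
/-- Random choices of all kernels avoid the ideal with frequency at least `(1 - |S| / Q) ^ η`, where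
`η` is the number of links carrying a kernel. -/
theorem pow_mul_card_le_card_notMem (link : C → E) (Y : C → β → R) (S : Finset ι)
    (g : ι → (C → R) → R) (hg : ∀ r ∈ S, LinkAffine link (g r)) (I : ℕ → Ideal R)
    (hI : Antitone I) (Q : ℕ)
    (hY : ∀ n c a₀ a, a ∉ I n →
      (Finset.univ.filter fun b => a₀ + a * Y c b ∈ I (n + 1)).card * Q ≤ Fintype.card β)
    (h0 : ∀ r ∈ S, ∃ κ, g r κ ∉ I 0) :
    Fintype.card (C → β) * (Q - S.card) ^ (Set.range link).ncard
      ≤ (Finset.univ.filter fun x : C → β =>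
          ∀ r ∈ S, g r (fun c => Y c (x c)) ∉ I (Set.range link).ncard).card
          * Q ^ (Set.range link).ncard := by
  have key : ∀ s : Finset E, Fintype.card (C → β) * (Q - S.card) ^ s.card
      ≤ (extendable link Y S g (I s.card) s).card * Q ^ s.card := by
    intro s
    induction s using Finset.induction_on with
    | empty =>
      have : extendable link Y S g (I 0) ∅ = Finset.univ := by
        refine Finset.filter_true_of_mem fun x _ r hr => ?_
        obtain ⟨κ, hκ⟩ := h0 r hr
        exact ⟨κ, by simp, hκ⟩
      simp [this]
    | insert e s he ih =>
      have h1 := card_extendable_insert link Y S g hg (I s.card) (I (s.card + 1))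
        (hI (Nat.le_succ _)) Q (hY _) s e he
      rw [Finset.card_insert_of_notMem he, pow_succ, pow_succ]
      calc _ = Fintype.card (C → β) * (Q - S.card) ^ s.card * (Q - S.card) := by ring
        _ ≤ (extendable link Y S g (I s.card) s).card * Q ^ s.card * (Q - S.card) :=
          Nat.mul_le_mul_right _ ih
        _ = (extendable link Y S g (I s.card) s).card * (Q - S.card) * Q ^ s.card := by ring
        _ ≤ _ := Nat.mul_le_mul_right _ h1
        _ = _ := by ring
  have hc : (Set.range link).ncard = (Finset.univ.image link).card := by
    rw [← Set.ncard_coe_finset]; simp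
  rw [hc]
  refine (key _).trans (Nat.mul_le_mul_right _ (Finset.card_le_card ?_))
  intro x hx
  simp only [extendable, Finset.mem_filter, Finset.mem_univ, true_and] at hx ⊢
  intro r hr
  obtain ⟨κ, h1, h2⟩ := hx r hr
  -- Every link is now exposed, so the witness is the sample itself.
  have : κ = fun c => Y c (x c) := funext fun c => h1 c (by simp)
  rwa [← this]

end Counting

/-! ### Edmonds matrix, Hall's theorem and the transfer matrix -/

section Transfer

variable {V E F : Type*} {m : ℕ} [Fintype E] [Field F]

open Classical in
/-- The Edmonds matrix of the network with decoding matrix `B`. -/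
noncomputable def edmondsMatrix (N : Network V E) (B : Matrix E (Fin m) F⟦X⟧)
    (κ : N.Coef m → F⟦X⟧) : Matrix (E ⊕ Fin m) (E ⊕ Fin m) F⟦X⟧ :=
  Matrix.fromBlocks (1 - localMatrix N κ) B (sourceMatrix N κ) 0

open Classical in
/-- The column of the link `e` in the Edmonds matrix, without the diagonal entry `1`. -/
noncomputable def linkColumn (N : Network V E) (e : E) :
    (N.Coef m → F⟦X⟧) →ₗ[F⟦X⟧] (E ⊕ Fin m → F⟦X⟧) where
  toFun κ := Sum.elim (fun e' => -localMatrix N κ e' e) (fun i => sourceMatrix N κ i e)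
  map_add' κ κ' := by
    funext j
    rcases j with e' | i
    · by_cases h : N.head e' = N.tail e <;> simp [localMatrix, h, add_comm]
    · by_cases h : N.tail e = N.source <;> simp [sourceMatrix, h]
  map_smul' a κ := by
    funext j
    rcases j with e' | i
    · by_cases h : N.head e' = N.tail e <;> simp [localMatrix, h]
    · by_cases h : N.tail e = N.source <;> simp [sourceMatrix, h]

-- Kernels of `e` occur only in column `Sum.inl e`, which is a unit vector plus `linkColumn`.
-- Cramer's map is the determinant as a linear function of that column.
open Classical in
theorem linkAffine_det_edmondsMatrix (N : Network V E) (B : Matrix E (Fin m) F⟦X⟧) :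
    LinkAffine N.link fun κ : N.Coef m → F⟦X⟧ => (edmondsMatrix N B κ).det := by
  intro e κ
  refine ⟨(edmondsMatrix N B κ).cramer (Pi.single (Sum.inl e) 1) (Sum.inl e),
    LinearMap.proj (Sum.inl e) ∘ₗ (edmondsMatrix N B κ).cramer ∘ₗ linkColumn N e, ?_⟩
  intro κ' h
  simp only [LinearMap.comp_apply, LinearMap.proj_apply]
  rw [← Pi.add_apply, ← map_add, Matrix.cramer_apply]
  congr 1
  ext i j
  rw [Matrix.updateCol_apply]
  split_ifs with hj
  · subst hj
    rcases i with e' | i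
    · simp [edmondsMatrix, linkColumn, Matrix.one_apply, Pi.single_apply, sub_eq_add_neg]
    · simp [edmondsMatrix, linkColumn]
  · rcases j with e'' | j
    · have hne : e'' ≠ e := fun h => hj (by rw [h])
      rcases i with e' | i
      · by_cases ha : N.head e' = N.tail e''
        · simp [edmondsMatrix, localMatrix, ha, h (Sum.inl ⟨(e', e''), ha⟩) hne]
        · simp [edmondsMatrix, localMatrix, ha]
      · by_cases ha : N.tail e'' = N.source
        · simp [edmondsMatrix, sourceMatrix, ha, h (Sum.inr (⟨e'', ha⟩, i)) hne]
        · simp [edmondsMatrix, sourceMatrix, ha]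
    · rcases i with e' | i <;> simp [edmondsMatrix]

/-- If every cut between the source and `r` has at least `m` edges, then the support of the Edmonds
matrix has a perfect matching. -/
theorem exists_perfect_matching (N : Network V E) (r : V) (hr : r ≠ N.source)
    (hcut : N.MinCutAtLeast m r) :
    ∃ σ : Equiv.Perm (E ⊕ Fin m),
      (∀ e e', σ (Sum.inl e) = Sum.inl e' → e = e' ∨ N.head e = N.tail e') ∧
      (∀ e i, σ (Sum.inl e) = Sum.inr i → N.head e = r) ∧
      (∀ i e, σ (Sum.inr i) = Sum.inl e → N.tail e = N.source) ∧
      ∀ i j, σ (Sum.inr i) ≠ Sum.inr j := by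
  classical
  let rel : E ⊕ Fin m → E ⊕ Fin m → Prop := fun a b =>
    Sum.elim (fun e => Sum.elim (fun e' => e = e' ∨ N.head e = N.tail e') (fun _ => N.head e = r) b)
      (fun _ => Sum.elim (fun e => N.tail e = N.source) (fun _ => False) b) a
  let nb : E ⊕ Fin m → Finset (E ⊕ Fin m) := fun a => Finset.univ.filter (rel a)
  have hall : ∀ s : Finset (E ⊕ Fin m), s.card ≤ (s.biUnion nb).card := by
    intro s
    have hsub : s.toLeft.map Function.Embedding.inl ⊆ s.biUnion nb := by
      intro b hb
      obtain ⟨e, he, rfl⟩ := Finset.mem_map.mp hb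
      exact Finset.mem_biUnion.mpr ⟨Sum.inl e, Finset.mem_toLeft.mp he,
        Finset.mem_filter.mpr ⟨Finset.mem_univ _, Or.inl rfl⟩⟩
    have hs : s.card = s.toLeft.card + s.toRight.card := Finset.card_toLeft_add_card_toRight.symm
    have hm : s.toRight.card ≤ m := by simpa using Finset.card_le_univ s.toRight
    -- Each edge is its own neighbour, which accounts for the edges in `s`. Hall's condition then
    -- needs only `m` neighbours outside them, and only if `s` contains a source index.
    suffices h : s.toRight.Nonempty → ∃ t : Finset (E ⊕ Fin m), m ≤ t.card ∧ t ⊆ s.biUnion nb ∧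
        Disjoint (s.toLeft.map Function.Embedding.inl) t by
      rcases s.toRight.eq_empty_or_nonempty with h0 | h0
      · rw [hs, h0]
        simpa using Finset.card_le_card hsub
      · obtain ⟨t, ht, hts, hdis⟩ := h h0
        have := Finset.card_le_card (Finset.union_subset hsub hts)
        rw [Finset.card_union_of_disjoint hdis, Finset.card_map] at this
        omega
    rintro ⟨i, hi⟩
    by_cases hh : ∃ e ∈ s.toLeft, N.head e = r
    · obtain ⟨e, he, her⟩ := hh
      refine ⟨Finset.univ.map Function.Embedding.inr, by simp, ?_, ?_⟩
      · intro b hb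
        obtain ⟨j, -, rfl⟩ := Finset.mem_map.mp hb
        exact Finset.mem_biUnion.mpr ⟨Sum.inl e, Finset.mem_toLeft.mp he,
          Finset.mem_filter.mpr ⟨Finset.mem_univ _, her⟩⟩
      · rw [Finset.disjoint_left]
        intro b hb hb'
        obtain ⟨e, -, rfl⟩ := Finset.mem_map.mp hb
        simp at hb'
    · push Not at hh
      -- The cut to use: the source and all heads of edges in `s`. Crossing edges are neighbours of
      -- `s` because their tails lie in `S`, and are not in `s` because their heads do not.
      set S : Set V := {v | v = N.source ∨ ∃ e ∈ s.toLeft, N.head e = v} with hS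
      have hc := hcut S (Or.inl rfl) (by
        rintro (h | ⟨e, he, her⟩)
        · exact hr h
        · exact hh e he her)
      rw [Set.ncard_eq_toFinset_card'] at hc
      refine ⟨({e : E | N.tail e ∈ S ∧ N.head e ∉ S}.toFinset).map Function.Embedding.inl,
        by rwa [Finset.card_map], ?_, ?_⟩
      · intro b hb
        obtain ⟨e, he, rfl⟩ := Finset.mem_map.mp hb
        rw [Set.mem_toFinset] at he
        rcases he.1 with h | ⟨e', he', h⟩
        · exact Finset.mem_biUnion.mpr ⟨Sum.inr i, Finset.mem_toRight.mp hi,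
            Finset.mem_filter.mpr ⟨Finset.mem_univ _, h⟩⟩
        · exact Finset.mem_biUnion.mpr
            ⟨Sum.inl e', Finset.mem_toLeft.mp he',
              Finset.mem_filter.mpr ⟨Finset.mem_univ _, Or.inr h⟩⟩
      · rw [Finset.disjoint_left]
        intro b hb hb'
        obtain ⟨e, he, rfl⟩ := Finset.mem_map.mp hb
        obtain ⟨e', he', h⟩ := Finset.mem_map.mp hb'
        rw [Function.Embedding.inl_apply, Function.Embedding.inl_apply, Sum.inl.injEq] at h
        subst h
        rw [Set.mem_toFinset] at he'
        exact he'.2 (Or.inr ⟨e', he, rfl⟩)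
  obtain ⟨f, hf, hrel⟩ := (Finset.all_card_le_biUnion_card_iff_exists_injective nb).mp hall
  have hrel' : ∀ a, rel a (f a) := fun a => (Finset.mem_filter.mp (hrel a)).2
  refine ⟨Equiv.ofBijective f (Finite.injective_iff_bijective.mp hf), ?_, ?_, ?_, ?_⟩
  · intro e e' h
    have := hrel' (Sum.inl e)
    rw [show f (Sum.inl e) = Sum.inl e' from h] at this
    exact this
  · intro e i h
    have := hrel' (Sum.inl e)
    rw [show f (Sum.inl e) = Sum.inr i from h] at this
    exact this
  · intro i e h
    have := hrel' (Sum.inr i)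
    rw [show f (Sum.inr i) = Sum.inl e from h] at this
    exact this
  · intro i j h
    have := hrel' (Sum.inr i)
    rw [show f (Sum.inr i) = Sum.inr j from h] at this
    exact this

/-- As a polynomial in `X`, the determinant has top coefficient `det` of the permutation matrix,
which is `±1`. -/
theorem det_X_smul_permMatrix_add_ne_zero {n : Type*} [Fintype n] [DecidableEq n] (σ : Equiv.Perm n)
    (A : Matrix n n F) :
    ((X : F⟦X⟧) • (σ.permMatrix F).map (C (R := F)) + A.map (C (R := F))).det ≠ 0 := by
  have h := Polynomial.coeff_det_X_add_C_card (σ.permMatrix F) A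
  have hne : ((Polynomial.X : Polynomial F) • (σ.permMatrix F).map Polynomial.C +
      A.map Polynomial.C).det ≠ 0 := by
    intro h0
    rw [h0, Matrix.det_permutation, Polynomial.coeff_zero] at h
    rcases Int.units_eq_one_or (Equiv.Perm.sign σ) with h1 | h1 <;> simp [h1] at h
  intro h0
  apply hne
  have hmap : (X : F⟦X⟧) • (σ.permMatrix F).map (C (R := F)) + A.map (C (R := F))
      = (Polynomial.coeToPowerSeries.ringHom : Polynomial F →+* F⟦X⟧).mapMatrix
        ((Polynomial.X : Polynomial F) • (σ.permMatrix F).map Polynomial.C +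
          A.map Polynomial.C) := by
    ext1 i j
    simp only [Matrix.add_apply, Matrix.smul_apply, Matrix.map_apply, RingHom.mapMatrix_apply,
      Matrix.map_apply, smul_eq_mul, map_add, map_mul]
    simp
  rw [hmap, ← RingHom.map_det] at h0
  exact Polynomial.coe_injective F (by simpa using h0)

open Classical in
/-- Over a network with sufficiently large cuts some kernels and some decoding matrix at `r` give a
nonsingular Edmonds matrix. -/
theorem exists_det_edmondsMatrix_ne_zero (N : Network V E) (r : V) (hr : r ≠ N.source)
    (hcut : N.MinCutAtLeast m r) :
    ∃ (B : Matrix E (Fin m) F⟦X⟧) (κ : N.Coef m → F⟦X⟧),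
      (∀ e i, N.head e ≠ r → B e i = 0) ∧ (edmondsMatrix N B κ).det ≠ 0 := by
  obtain ⟨σ, h1, h2, h3, h4⟩ := exists_perfect_matching N r hr hcut
  set B : Matrix E (Fin m) F⟦X⟧ := fun e i => if σ (Sum.inl e) = Sum.inr i then X else 0 with hB
  set κ : N.Coef m → F⟦X⟧ := Sum.elim
    (fun p => if p.1.1 ≠ p.1.2 ∧ σ (Sum.inl p.1.1) = Sum.inl p.1.2 then -X else 0)
    (fun p => if σ (Sum.inr p.2) = Sum.inl p.1.1 then X else 0) with hκ
  refine ⟨B, κ, fun e i he => if_neg fun h => he (h2 e i h), ?_⟩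
  -- At a fixed point of `σ` the matched entry is the diagonal `1`, not `X`; scaling that row by `X`
  -- makes all matched entries `X`. The diagonal ones left in the other edge rows form `J`.
  let w : E ⊕ Fin m → F⟦X⟧ := fun a => if σ a = a then X else 1
  let J : E ⊕ Fin m → F := Sum.elim (fun e => if σ (Sum.inl e) = Sum.inl e then 0 else 1) 0
  have key : Matrix.diagonal w * edmondsMatrix N B κ =
      (X : F⟦X⟧) • (σ.permMatrix F).map (C (R := F)) + (Matrix.diagonal J).map (C (R := F)) := by
    ext1 a b
    rw [Matrix.diagonal_mul]
    have hP : ∀ a b, (σ.permMatrix F) a b = if σ a = b then 1 else 0 := by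
      intro a b
      simp [Equiv.Perm.permMatrix, PEquiv.toMatrix_apply, Equiv.toPEquiv_apply, eq_comm]
    rw [Matrix.add_apply, Matrix.smul_apply, Matrix.map_apply, Matrix.map_apply, hP]
    rcases a with e | i <;> rcases b with e' | j
    · by_cases hee : e = e'
      · subst hee
        by_cases hs : σ (Sum.inl e) = Sum.inl e
        · by_cases ha : N.head e = N.tail e <;>
            simp [w, J, edmondsMatrix, localMatrix, hs, ha, hκ]
        · by_cases ha : N.head e = N.tail e <;>
            simp [w, J, edmondsMatrix, localMatrix, hs, ha, hκ]
      · by_cases hs : σ (Sum.inl e) = Sum.inl e'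
        · have ha : N.head e = N.tail e' := (h1 e e' hs).resolve_left hee
          simp [w, edmondsMatrix, localMatrix, hs, ha, hκ, hee, Ne.symm hee]
        · by_cases ha : N.head e = N.tail e' <;>
            simp [w, edmondsMatrix, localMatrix, hs, ha, hκ, hee]
    · have hBe : B e j = if σ (Sum.inl e) = Sum.inr j then X else 0 := rfl
      by_cases hs : σ (Sum.inl e) = Sum.inr j <;> simp [w, edmondsMatrix, hBe, hs]
    · by_cases hs : σ (Sum.inr i) = Sum.inl e'
      · simp [w, edmondsMatrix, sourceMatrix, hs, h3 i e' hs, hκ]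
      · by_cases ha : N.tail e' = N.source <;>
          simp [w, edmondsMatrix, sourceMatrix, hs, ha, hκ]
    · simp [J, edmondsMatrix, h4 i j, Matrix.diagonal_apply]
  have := det_X_smul_permMatrix_add_ne_zero σ (Matrix.diagonal J)
  rw [← key, Matrix.det_mul] at this
  exact right_ne_zero_of_mul this

open Classical in
/-- Up to a factor, the Edmonds determinant is the determinant of the decoded transfer matrix. -/
theorem exists_det_edmondsMatrix_eq (N : Network V E) (D : Set N.AdjPair) (hD : N.Admissible D)
    (κ : N.Coef m → F⟦X⟧) (hκ : ∀ p ∈ D, constantCoeff (κ (Sum.inl p)) = 0) (r : V)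
    (B : Matrix E (Fin m) F⟦X⟧) (hB : ∀ e i, N.head e ≠ r → B e i = 0) :
    ∃ a, (edmondsMatrix N B κ).det
      = a * (nodeMatrix N κ r * B.submatrix (fun e : {e // N.head e = r} => e.1) id).det := by
  have hu : IsUnit (1 - localMatrix N κ).det := by
    convert isUnit_one_sub_localMatrix N D hD κ hκ
  let := Matrix.invertibleOfIsUnitDet _ hu
  have hG : nodeMatrix N κ r * B.submatrix (fun e : {e // N.head e = r} => e.1) id
      = globalMatrix N κ * B := by
    ext1 i j
    rw [Matrix.mul_apply, Matrix.mul_apply,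
      ← Finset.sum_subset (Finset.subset_univ (Finset.univ.filter fun e => N.head e = r))]
    · exact (Finset.sum_subtype (Finset.univ.filter fun e => N.head e = r) (by simp)
        fun e => globalMatrix N κ i e * B e j).symm
    · intro e _ he
      rw [hB e j (by simpa using he), mul_zero]
  rw [hG]
  refine ⟨(1 - localMatrix N κ).det * (-1) ^ m, ?_⟩
  rw [edmondsMatrix, Matrix.det_fromBlocks₁₁, zero_sub, Matrix.det_neg, Fintype.card_fin,
    Matrix.invOf_eq_nonsing_inv, mul_assoc]
  rfl

end Transfer

/-! ### From determinants to the two decodability tests -/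

section Tests

variable {V E F : Type*} {m : ℕ} [Fintype E] [Field F]

open Classical in
theorem fullRankTest_of_det_ne_zero (N : Network V E) (κ : N.Coef m → F⟦X⟧) (t : ℕ) (r : V)
    (B : Matrix {e // N.head e = r} (Fin m) F⟦X⟧) (h : (nodeMatrix N κ r * B).det ≠ 0) :
    fullRankTest N κ t r := by
  set φ := algebraMap F⟦X⟧ (FractionRing F⟦X⟧)
  have hu : IsUnit ((nodeMatrix N κ r).map φ * B.map φ) := by
    rw [← Matrix.map_mul, Matrix.isUnit_iff_isUnit_det, isUnit_iff_ne_zero,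
      ← RingHom.mapMatrix_apply, ← RingHom.map_det]
    exact fun h0 => h (IsFractionRing.injective F⟦X⟧ (FractionRing F⟦X⟧) (by rw [h0, map_zero]))
  refine le_antisymm ((Matrix.rank_le_card_height _).trans_eq (Fintype.card_fin m)) ?_
  have := Matrix.rank_mul_le_left ((nodeMatrix N κ r).map φ) (B.map φ)
  rwa [Matrix.rank_of_isUnit _ hu, Fintype.card_fin] at this

open Classical in
theorem vecMul_toeplitz_apply (N : Network V E) (κ : N.Coef m → F⟦X⟧) (r : V) (n : ℕ)
    (v : Fin n × Fin m → F) (b : Fin n) (j : {e // N.head e = r}) :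
    Matrix.vecMul v (toeplitz N κ r n) (b, j) = ∑ a, ∑ i, v (a, i) *
      if a ≤ b then coeff ((b : ℕ) - (a : ℕ)) (nodeMatrix N κ r i j) else 0 := by
  rw [Matrix.vecMul, dotProduct, Fintype.sum_prod_type]
  rfl

/-- Insertion of a zero block in front. -/
def shiftBlock (F : Type*) [Field F] (m n : ℕ) :
    (Fin n × Fin m → F) →ₗ[F] (Fin (n + 1) × Fin m → F) where
  toFun v p := Fin.cases 0 (fun a => v (a, p.2)) p.1
  map_add' v w := by
    funext ⟨a, i⟩
    refine Fin.cases ?_ (fun a => ?_) a <;> simp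
  map_smul' c v := by
    funext ⟨a, i⟩
    refine Fin.cases ?_ (fun a => ?_) a <;> simp

theorem shiftBlock_zero (n : ℕ) (v : Fin n × Fin m → F) (i : Fin m) :
    shiftBlock F m n v (0, i) = 0 := rfl

theorem shiftBlock_succ (n : ℕ) (v : Fin n × Fin m → F) (a : Fin n) (i : Fin m) :
    shiftBlock F m n v (a.succ, i) = v (a, i) := rfl

theorem shiftBlock_injective (n : ℕ) : Function.Injective (shiftBlock F m n) := by
  intro v w h
  funext ⟨a, i⟩
  exact congrFun h (a.succ, i)

open Classical in
theorem vecMul_shiftBlock_zero (N : Network V E) (κ : N.Coef m → F⟦X⟧) (r : V) (n : ℕ)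
    (v : Fin n × Fin m → F) (j : {e // N.head e = r}) :
    Matrix.vecMul (shiftBlock F m n v) (toeplitz N κ r (n + 1)) (0, j) = 0 := by
  rw [vecMul_toeplitz_apply, Fin.sum_univ_succ]
  simp [shiftBlock_zero]

open Classical in
theorem vecMul_shiftBlock_succ (N : Network V E) (κ : N.Coef m → F⟦X⟧) (r : V) (n : ℕ)
    (v : Fin n × Fin m → F) (b : Fin n) (j : {e // N.head e = r}) :
    Matrix.vecMul (shiftBlock F m n v) (toeplitz N κ r (n + 1)) (b.succ, j)
      = Matrix.vecMul v (toeplitz N κ r n) (b, j) := by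
  rw [vecMul_toeplitz_apply, vecMul_toeplitz_apply, Fin.sum_univ_succ]
  simp [shiftBlock_zero, shiftBlock_succ]

-- If every left null vector has zero first block, the left kernel at size `t + 1` is the shifted
-- kernel at size `t`. Equal nullities and `m` more rows make the rank grow by exactly `m`.
open Classical in
theorem toeplitzTest_of_ker (N : Network V E) (κ : N.Coef m → F⟦X⟧) (t : ℕ) (r : V)
    (h : ∀ v : Fin (t + 1) × Fin m → F, Matrix.vecMul v (toeplitz N κ r (t + 1)) = 0 →
      ∀ i, v (0, i) = 0) :
    toeplitzTest N κ t r := by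
  have hrank : ∀ n, (toeplitz N κ r n).rank
      + Module.finrank F (LinearMap.ker (toeplitz N κ r n).vecMulLinear) = n * m := by
    intro n
    have := LinearMap.finrank_range_add_finrank_ker (toeplitz N κ r n).vecMulLinear
    rw [← Matrix.rank_transpose, Matrix.rank, Matrix.mulVecLin_transpose, this]
    simp
  have hker : LinearMap.ker (toeplitz N κ r (t + 1)).vecMulLinear
      = (LinearMap.ker (toeplitz N κ r t).vecMulLinear).map (shiftBlock F m t) := by
    ext v
    simp only [Submodule.mem_map, LinearMap.mem_ker, Matrix.vecMulLinear_apply]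
    constructor
    · intro hv
      have hvs : shiftBlock F m t (fun p => v (p.1.succ, p.2)) = v := by
        funext ⟨a, i⟩
        refine Fin.cases ?_ (fun a => ?_) a
        · rw [shiftBlock_zero, h v hv]
        · rw [shiftBlock_succ]
      refine ⟨_, ?_, hvs⟩
      funext ⟨b, j⟩
      rw [← vecMul_shiftBlock_succ, hvs, hv]
      rfl
    · rintro ⟨w, hw, rfl⟩
      funext ⟨b, j⟩
      refine Fin.cases ?_ (fun b => ?_) b
      · rw [vecMul_shiftBlock_zero]; rfl
      · rw [vecMul_shiftBlock_succ, hw]; rfl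
  have hfin : Module.finrank F (LinearMap.ker (toeplitz N κ r (t + 1)).vecMulLinear)
      = Module.finrank F (LinearMap.ker (toeplitz N κ r t).vecMulLinear) := by
    rw [hker]
    exact (LinearEquiv.finrank_eq
      (Submodule.equivMapOfInjective _ (shiftBlock_injective t) _)).symm
  have h1 := hrank t
  have h2 := hrank (t + 1)
  rw [hfin, add_mul, one_mul] at h2
  rw [toeplitzTest]
  omega

theorem X_dvd_of_X_pow_dvd_mul {n : ℕ} {a b : F⟦X⟧} (hb : ¬ X ^ n ∣ b) (h : X ^ n ∣ b * a) :
    X ∣ a := by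
  rw [X_dvd_iff]
  by_contra ha
  have hu : IsUnit a := PowerSeries.isUnit_iff_constantCoeff.mpr (isUnit_iff_ne_zero.mpr ha)
  exact hb (hu.dvd_mul_right.mp h)

-- A left null vector is a polynomial row `p` with `p F_r ≡ 0` modulo `X ^ (t + 1)`. Multiplying by
-- `B` and the adjugate gives `det · p ≡ 0`; as `X ^ (t + 1)` does not divide `det`, no entry of `p`
-- is a unit, so its constant terms vanish.
open Classical in
theorem toeplitzTest_of_not_X_pow_dvd_det (N : Network V E) (κ : N.Coef m → F⟦X⟧) (t : ℕ) (r : V)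
    (B : Matrix {e // N.head e = r} (Fin m) F⟦X⟧)
    (h : ¬ X ^ (t + 1) ∣ (nodeMatrix N κ r * B).det) :
    toeplitzTest N κ t r := by
  refine toeplitzTest_of_ker N κ t r fun v hv i => ?_
  set M := nodeMatrix N κ r * B
  let p : Fin m → F⟦X⟧ := fun i => ∑ a : Fin (t + 1), C (v (a, i)) * X ^ (a : ℕ)
  have h1 : ∀ j, X ^ (t + 1) ∣ Matrix.vecMul p (nodeMatrix N κ r) j := by
    intro j
    rw [X_pow_dvd_iff]
    intro b hb
    have hvb := congrFun hv (⟨b, hb⟩, j)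
    rw [vecMul_toeplitz_apply, Finset.sum_comm] at hvb
    rw [Matrix.vecMul, dotProduct, map_sum]
    refine Eq.trans (Finset.sum_congr rfl fun i _ => ?_) hvb
    rw [Finset.sum_mul, map_sum]
    refine Finset.sum_congr rfl fun a _ => ?_
    rw [mul_assoc, coeff_C_mul, coeff_X_pow_mul']
    rfl
  have h2 : Matrix.vecMul (Matrix.vecMul p M) M.adjugate = M.det • p := by
    rw [Matrix.vecMul_vecMul, Matrix.mul_adjugate, Matrix.vecMul_smul, Matrix.vecMul_one]
  have h3 : X ^ (t + 1) ∣ M.det * p i := by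
    change X ^ (t + 1) ∣ (M.det • p) i
    rw [← h2]
    change X ^ (t + 1) ∣ ∑ k, Matrix.vecMul p M k * M.adjugate k i
    refine Finset.dvd_sum fun k _ => Dvd.dvd.mul_right (b := Matrix.vecMul p M k) ?_ _
    rw [← Matrix.vecMul_vecMul]
    change X ^ (t + 1) ∣ ∑ j, Matrix.vecMul p (nodeMatrix N κ r) j * B j k
    exact Finset.dvd_sum fun j _ => Dvd.dvd.mul_right (h1 j) _
  have h4 := X_dvd_iff.mp (X_dvd_of_X_pow_dvd_mul h h3)
  rw [map_sum, Fin.sum_univ_succ] at h4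
  simpa using h4

end Tests

/-! ### The run before and after acknowledgement -/

section Run

variable {V E F : Type*} {m : ℕ} [Field F]

/-- The kernels relevant for `F_r(z)` are those on links whose tail has `r` downstream. -/
theorem nodeMatrix_congr [Fintype E] (N : Network V E) (D : Set N.AdjPair) (hD : N.Admissible D)
    (κ κ' : N.Coef m → F⟦X⟧) (hκ : ∀ p ∈ D, constantCoeff (κ (Sum.inl p)) = 0)
    (hκ' : ∀ p ∈ D, constantCoeff (κ' (Sum.inl p)) = 0) (r : V)
    (h : ∀ c, N.Downstream (N.tail (N.link c)) r → κ c = κ' c) :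
    nodeMatrix N κ r = nodeMatrix N κ' r := by
  classical
  -- Erasing the kernels with no path to `r` erases exactly the columns of such links: an edge
  -- feeding a link upstream of `r` is itself upstream of `r`, so the truncated columns solve the
  -- truncated encoding equations.
  have key : ∀ κ : N.Coef m → F⟦X⟧, (∀ p ∈ D, constantCoeff (κ (Sum.inl p)) = 0) →
      (fun i e => if N.Downstream (N.tail e) r then globalMatrix N κ i e else 0)
        = globalMatrix N fun c => if N.Downstream (N.tail (N.link c)) r then κ c else 0 := by
    intro κ hκ
    have hG := (globalMatrix_unique N D hD κ hκ (globalMatrix N κ)).mp rfl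
    refine (globalMatrix_unique N D hD _ (fun p hp => ?_) _).mpr fun i e => ?_
    · split_ifs
      · exact hκ p hp
      · simp
    by_cases he : N.Downstream (N.tail e) r
    · simp only [he, if_true]
      rw [hG i e]
      congr 1
      · by_cases hs : N.tail e = N.source
        · have : N.Downstream (N.tail (N.link (m := m) (Sum.inr (⟨e, hs⟩, i)))) r := he
          simp [sourceMatrix, hs, this]
        · simp [sourceMatrix, hs]
      · refine Finset.sum_congr rfl fun e' _ => ?_
        by_cases ha : N.head e' = N.tail e
        · have h1 : N.Downstream (N.tail e') r :=
            Relation.TransGen.head ⟨e', rfl, ha⟩ he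
          have h2 : N.Downstream (N.tail (N.link (m := m) (Sum.inl ⟨(e', e), ha⟩))) r := he
          simp [localMatrix, ha, h1, h2]
        · simp [localMatrix, ha]
    · simp only [he, if_false]
      symm
      refine add_eq_zero_iff_eq_neg.mpr ?_
      have h1 : ∀ e', localMatrix N
          (fun c => if N.Downstream (N.tail (N.link c)) r then κ c else 0) e' e = 0 := by
        intro e'
        by_cases ha : N.head e' = N.tail e
        · have h2 : ¬ N.Downstream (N.tail (N.link (m := m) (Sum.inl ⟨(e', e), ha⟩))) r := he
          simp [localMatrix, ha, h2]
        · simp [localMatrix, ha]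
      rw [Finset.sum_eq_zero fun e' _ => by rw [h1, mul_zero], neg_zero]
      by_cases hs : N.tail e = N.source
      · have h2 : ¬ N.Downstream (N.tail (N.link (m := m) (Sum.inr (⟨e, hs⟩, i)))) r := he
        simp [sourceMatrix, hs, h2]
      · simp [sourceMatrix, hs]
  have heq : (fun c => if N.Downstream (N.tail (N.link c)) r then κ c else 0)
      = fun c => if N.Downstream (N.tail (N.link c)) r then κ' c else 0 := by
    funext c
    split_ifs with hc
    · exact h c hc
    · rfl
  have h1 := (key κ hκ).trans (heq ▸ (key κ' hκ').symm)
  ext1 i e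
  have h2 := congrFun (congrFun h1 i) e.1
  have hd : N.Downstream (N.tail e.1) r := Relation.TransGen.single ⟨e.1, rfl, e.2⟩
  simp only [hd, if_true] at h2
  exact h2

open Classical in
/-- The kernel at `c` made of the coefficients `b` drawn up to time `t`. -/
noncomputable def truncKernel (N : Network V E) (D : Set N.AdjPair) (t : ℕ) (c : N.Coef m)
    (b : Fin (t + 1) → F) : F⟦X⟧ :=
  PowerSeries.mk fun n =>
    if h : n < t + 1 then (if n = 0 ∧ ∃ p ∈ D, c = Sum.inl p then 0 else b ⟨n, h⟩) else 0

theorem constantCoeff_truncKernel (N : Network V E) (D : Set N.AdjPair) (t : ℕ) (p : N.AdjPair)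
    (hp : p ∈ D) (b : Fin (t + 1) → F) :
    constantCoeff (truncKernel N D t (Sum.inl p : N.Coef m) b) = 0 := by
  rw [← coeff_zero_eq_constantCoeff_apply, truncKernel, coeff_mk]
  simp [hp]

variable (N : Network V E) (R : Finset V) (D : Set N.AdjPair)
  (test : (N.Coef m → F⟦X⟧) → ℕ → V → Prop) (x : N.Coef m × ℕ → F)

theorem exists_test_of_mem_acked (t : ℕ) (r : V) (h : r ∈ (run N R D test x t).acked) :
    ∃ s ≤ t, test (run N R D test x s).kernel s r := by
  induction t with
  | zero => exact ⟨0, le_rfl, h.2⟩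
  | succ t ih =>
    rcases h with h | h
    · obtain ⟨s, hs, hst⟩ := ih h
      exact ⟨s, hs.trans t.le_succ, hst⟩
    · exact ⟨t + 1, le_rfl, h.2⟩

theorem mem_acked_of_test (t : ℕ) (r : V) (hr : r ∈ R)
    (h : test (run N R D test x t).kernel t r) : r ∈ (run N R D test x t).acked := by
  cases t with
  | zero => exact ⟨hr, h⟩
  | succ t => exact Or.inr ⟨hr, h⟩

theorem monotone_acked : Monotone fun t => (run N R D test x t).acked :=
  monotone_nat_of_le_succ fun _ => Set.subset_union_left

/-- A node with `r` downstream cannot stop while `r` has not acknowledged, so its kernels contain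
every coefficient drawn. -/
theorem run_kernel_eq_truncKernel (r : V) (hr : r ∈ R) (t : ℕ)
    (h : ∀ s < t, ¬ test (run N R D test x s).kernel s r) (c : N.Coef m)
    (hc : N.Downstream (N.tail (N.link c)) r) :
    (run N R D test x t).kernel c = truncKernel N D t c fun s => x (c, s) := by
  classical
  induction t with
  | zero =>
    ext n
    simp only [run, truncKernel, coeff_monomial, coeff_mk]
    by_cases hn : n = 0
    · subst hn; simp
    · simp [hn]
  | succ t ih =>
    have hs : ¬ Stopped N R (run N R D test x t).acked (N.tail (N.link c)) := by
      intro hs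
      obtain ⟨s, hst, hts⟩ := exists_test_of_mem_acked N R D test x t r (hs r hr hc)
      exact h s (by omega) hts
    simp only [run]
    rw [ih fun s hs => h s (by omega), if_neg hs]
    ext n
    simp only [truncKernel, map_add, coeff_monomial, coeff_mk]
    rcases lt_trichotomy n (t + 1) with hn | hn | hn
    · simp [hn, hn.ne, hn.trans (Nat.lt_succ_self _)]
    · subst hn; simp
    · have h1 : ¬ n < t + 1 := by omega
      have h2 : ¬ n < t + 1 + 1 := by omega
      simp [h1, h2, hn.ne']

theorem firstDecodingTime_le_of_test_truncKernel [Fintype E] (hD : N.Admissible D) (r : V) (hr : r ∈ R)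
    (t : ℕ) (htest : ∀ κ κ', nodeMatrix N κ r = nodeMatrix N κ' r → test κ t r → test κ' t r)
    (h : test (fun c => truncKernel N D t c fun s => x (c, s)) t r) :
    firstDecodingTime N R D test x r ≤ t := by
  by_contra hlt
  have hno : ∀ s ≤ t, ¬ test (run N R D test x s).kernel s r := by
    intro s hs hts
    exact hlt ((iInf₂_le s hts).trans (by exact_mod_cast hs))
  refine hno t le_rfl (htest _ _ (nodeMatrix_congr N D hD _ _
    (fun p hp => constantCoeff_truncKernel N D t p hp _)
    (constantCoeff_run N R D test x t) r fun c hc => ?_) h)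
  exact (run_kernel_eq_truncKernel N R D test x r hr t (fun s hs => hno s hs.le) c hc).symm

/-- Once all sinks have acknowledged, every node has stopped and only zeros are added. -/
theorem exists_kernel_eq_of_networkTime_lt_top (h : networkTime N R D test x < ⊤) :
    ∃ t₀ : ℕ, ∀ t : ℕ, t₀ ≤ t →
      (run N R D test x t).kernel = (run N R D test x t₀).kernel := by
  have hr : ∀ r ∈ R, ∃ t, test (run N R D test x t).kernel t r := by
    intro r hr
    have h1 : firstDecodingTime N R D test x r < ⊤ := (Finset.le_sup hr).trans_lt h
    simp only [firstDecodingTime, iInf_lt_iff] at h1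
    obtain ⟨t, ht, -⟩ := h1
    exact ⟨t, ht⟩
  choose! τ hτ using hr
  refine ⟨R.sup τ, fun t ht => ?_⟩
  induction t, ht using Nat.le_induction with
  | base => rfl
  | succ t ht ih =>
    have hs : ∀ v, Stopped N R (run N R D test x t).acked v := fun v r hr _ =>
      monotone_acked N R D test x ((Finset.le_sup hr).trans ht)
        (mem_acked_of_test N R D test x (τ r) r hr (hτ r hr))
    rw [← ih]
    funext c
    simp [run, hs]

end Run

/-! ### How often a random truncated kernel hits an ideal -/

section Frequency

/-- Overwriting the `T`-coordinates of members of `S` arbitrarily is injective, since on `T` all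
members agree. -/
theorem card_mul_card_pow_le {F : Type*} [Fintype F] {n : ℕ} (S : Finset (Fin n → F)) (T : Finset (Fin n))
    (h : ∀ b ∈ S, ∀ b' ∈ S, ∀ i ∈ T, b i = b' i) :
    S.card * Fintype.card F ^ T.card ≤ Fintype.card (Fin n → F) := by
  classical
  have h1 : S.card * Fintype.card F ^ T.card
      = (S ×ˢ (Finset.univ : Finset (T → F))).card := by
    simp [Finset.card_product]
  rw [h1, ← Finset.card_univ]
  refine Finset.card_le_card_of_injOn (fun p i => if hi : i ∈ T then p.2 ⟨i, hi⟩ else p.1 i)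
    (by intro _ _; simp) ?_
  rintro ⟨b, v⟩ hb ⟨b', v'⟩ hb' heq
  have hbS : b ∈ S := by simpa using hb
  have hbS' : b' ∈ S := by simpa using hb'
  refine Prod.ext (funext fun i => ?_) (funext fun ⟨i, hi⟩ => ?_)
  · by_cases hi : i ∈ T
    · exact h b hbS b' hbS' i hi
    · simpa [hi] using congrFun heq i
  · simpa [hi] using congrFun heq i

variable {V E F : Type*} {m : ℕ} [Field F] [Fintype F]

open Classical in
theorem card_filter_truncKernel_mul_le (N : Network V E) (D : Set N.AdjPair) (t : ℕ)
    (c : N.Coef m) (a₀ a : F⟦X⟧) (J : Ideal F⟦X⟧) (T : Finset (Fin (t + 1)))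
    (h : ∀ b b', a * (truncKernel N D t c b - truncKernel N D t c b') ∈ J →
      ∀ i ∈ T, b i = b' i) :
    (Finset.univ.filter fun b => a₀ + a * truncKernel N D t c b ∈ J).card
      * Fintype.card F ^ T.card ≤ Fintype.card (Fin (t + 1) → F) := by
  refine card_mul_card_pow_le _ T fun b hb b' hb' => h b b' ?_
  simp only [Finset.mem_filter, Finset.mem_univ, true_and] at hb hb'
  have := J.sub_mem hb hb'
  rwa [add_sub_add_left_eq_sub, ← mul_sub] at this

omit [Fintype F] in
theorem coeff_truncKernel (N : Network V E) (D : Set N.AdjPair) (t : ℕ) (c : N.Coef m)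
    (b : Fin (t + 1) → F) (i : Fin (t + 1)) (hi : i ≠ 0 ∨ D = ∅) :
    coeff (i : ℕ) (truncKernel N D t c b) = b i := by
  have hn : ¬ ((i : ℕ) = 0 ∧ ∃ p ∈ D, c = Sum.inl p) := by
    rintro ⟨h0, p, hp, -⟩
    rcases hi with hi | hi
    · exact hi (Fin.ext h0)
    · simp [hi] at hp
  rw [truncKernel, coeff_mk, dif_pos i.2, if_neg hn]

/-- The positions `1, …, l`. -/
def positions (t l : ℕ) : Finset (Fin (t + 1)) :=
  -- Position `0` is left out because a delayed kernel ignores its coefficient there.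
  Finset.univ.filter fun i => i ≠ 0 ∧ (i : ℕ) ≤ l

theorem card_positions (t l : ℕ) (h : l ≤ t) : (positions t l).card = l := by
  have : (positions t l).map Fin.valEmbedding = Finset.Icc 1 l := by
    ext k
    simp only [positions, Finset.mem_map, Finset.mem_filter, Finset.mem_univ, true_and,
      Fin.valEmbedding_apply, Finset.mem_Icc]
    constructor
    · rintro ⟨i, ⟨h0, h1⟩, rfl⟩
      have : (i : ℕ) ≠ 0 := fun h => h0 (Fin.ext h)
      omega
    · rintro ⟨h1, h2⟩
      refine ⟨⟨k, by omega⟩, ⟨fun h => ?_, h2⟩, rfl⟩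
      have := congrArg Fin.val h
      simp at this
      omega
  rw [← Finset.card_map Fin.valEmbedding, this, Nat.card_Icc]
  omega

-- `a` has order at most `n - 1`, so `b` must supply at least `l + 1` factors of `X`.
omit [Fintype F] in
theorem X_pow_succ_dvd_of_X_pow_dvd_mul {n l : ℕ} {a b : F⟦X⟧} (ha : ¬ X ^ n ∣ a)
    (h : X ^ (n + l) ∣ a * b) : X ^ (l + 1) ∣ b := by
  induction l generalizing b with
  | zero => simpa using X_dvd_of_X_pow_dvd_mul ha h
  | succ l ih =>
    obtain ⟨b, rfl⟩ := X_dvd_of_X_pow_dvd_mul ha (dvd_trans (pow_dvd_pow X (by omega)) h)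
    rw [pow_succ' X (l + 1)]
    refine mul_dvd_mul_left X (ih ?_)
    rw [← add_assoc, pow_succ', mul_left_comm] at h
    exact (mul_dvd_mul_iff_left X_ne_zero).mp h

omit [Fintype F] in
theorem eq_on_of_forall_coeff_sub_eq_zero (N : Network V E) (D : Set N.AdjPair) (t : ℕ)
    (c : N.Coef m) (b b' : Fin (t + 1) → F) (i : Fin (t + 1)) (hi : i ≠ 0 ∨ D = ∅)
    (h : coeff (i : ℕ) (truncKernel N D t c b - truncKernel N D t c b') = 0) : b i = b' i := by
  rwa [map_sub, coeff_truncKernel N D t c b i hi, coeff_truncKernel N D t c b' i hi,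
    sub_eq_zero] at h

-- Two kernels hitting the ideal differ by a multiple of `X ^ (l + 1)`, so the coefficients at `1,
-- …, l` are forced.
open Classical in
theorem card_filter_mem_span_X_pow_mul_le (N : Network V E) (D : Set N.AdjPair) (t l n : ℕ)
    (hl : l ≤ t) (c : N.Coef m) (a₀ a : F⟦X⟧) (ha : a ∉ Ideal.span {(X : F⟦X⟧) ^ n}) :
    (Finset.univ.filter fun b =>
        a₀ + a * truncKernel N D t c b ∈ Ideal.span {(X : F⟦X⟧) ^ (n + l)}).card
      * Fintype.card F ^ l ≤ Fintype.card (Fin (t + 1) → F) := by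
  have key := card_filter_truncKernel_mul_le N D t c a₀ a (Ideal.span {(X : F⟦X⟧) ^ (n + l)})
    (positions t l) fun b b' h i hi => ?_
  · rwa [card_positions t l hl] at key
  rw [Ideal.mem_span_singleton] at ha h
  simp only [positions, Finset.mem_filter, Finset.mem_univ, true_and] at hi
  exact eq_on_of_forall_coeff_sub_eq_zero N D t c b b' i (Or.inl hi.1)
    (X_pow_dvd_iff.mp (X_pow_succ_dvd_of_X_pow_dvd_mul ha h) i (by omega))

open Classical in
theorem card_filter_mem_bot_mul_le (N : Network V E) (D : Set N.AdjPair) (t : ℕ)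
    (c : N.Coef m) (a₀ a : F⟦X⟧) (ha : a ∉ (⊥ : Ideal F⟦X⟧)) :
    (Finset.univ.filter fun b => a₀ + a * truncKernel N D t c b ∈ (⊥ : Ideal F⟦X⟧)).card
      * Fintype.card F ^ t ≤ Fintype.card (Fin (t + 1) → F) := by
  have key := card_filter_truncKernel_mul_le N D t c a₀ a ⊥ (positions t t) fun b b' h i hi => ?_
  · rwa [card_positions t t le_rfl] at key
  rw [Ideal.mem_bot] at ha h
  simp only [positions, Finset.mem_filter, Finset.mem_univ, true_and] at hi
  refine eq_on_of_forall_coeff_sub_eq_zero N D t c b b' i (Or.inl hi.1) ?_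
  rw [(mul_eq_zero.mp h).resolve_left ha, map_zero]

-- Without delays the coefficient at `0` is free as well, which gains the factor `q` responsible for
-- the earlier explicit time.
open Classical in
theorem card_filter_mem_bot_mul_le_of_eq_empty (N : Network V E) (t : ℕ)
    (c : N.Coef m) (a₀ a : F⟦X⟧) (ha : a ∉ (⊥ : Ideal F⟦X⟧)) :
    (Finset.univ.filter fun b => a₀ + a * truncKernel N ∅ t c b ∈ (⊥ : Ideal F⟦X⟧)).card
      * Fintype.card F ^ (t + 1) ≤ Fintype.card (Fin (t + 1) → F) := by
  have key := card_filter_truncKernel_mul_le N ∅ t c a₀ a ⊥ Finset.univ fun b b' h i _ => ?_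
  · rwa [Finset.card_univ, Fintype.card_fin] at key
  rw [Ideal.mem_bot] at ha h
  refine eq_on_of_forall_coeff_sub_eq_zero N ∅ t c b b' i (Or.inr rfl) ?_
  rw [(mul_eq_zero.mp h).resolve_left ha, map_zero]

end Frequency

/-! ### From frequencies to probabilities -/

section Probability

variable {V E F Ω : Type*} {m : ℕ} [Field F] [Fintype F] [MeasurableSpace F]
  [MeasurableSingletonClass F] [MeasurableSpace Ω] {μ : Measure Ω}

/-- The coefficients drawn up to time `t` are uniformly distributed. -/
theorem measure_coeffs_mem_le {C : Type*} [Fintype C] (X : C × ℕ → Ω → F) (hindep : iIndepFun X μ)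
    (hunif : ∀ j a, μ {ω | X j ω = a} = (Fintype.card F : ℝ≥0∞)⁻¹) (t : ℕ)
    (S : Finset (C → Fin (t + 1) → F)) :
    μ {ω | (fun c (s : Fin (t + 1)) => X (c, (s : ℕ)) ω) ∈ S}
      ≤ ENNReal.ofReal (S.card / Fintype.card F ^ (Fintype.card C * (t + 1))) := by
  have hinj : Function.Injective fun p : C × Fin (t + 1) => ((p.1, (p.2 : ℕ)) : C × ℕ) := by
    rintro ⟨c, s⟩ ⟨c', s'⟩ h
    simp only [Prod.mk.injEq] at h
    exact Prod.ext h.1 (Fin.ext h.2)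
  have h1 : ∀ x : C → Fin (t + 1) → F,
      μ {ω | (fun c (s : Fin (t + 1)) => X (c, (s : ℕ)) ω) = x}
        = (Fintype.card F : ℝ≥0∞)⁻¹ ^ (Fintype.card C * (t + 1)) := by
    intro x
    have h2 := (hindep.precomp hinj).measure_inter_preimage_eq_mul Finset.univ
      (sets := fun p => {x p.1 p.2}) fun p _ => measurableSet_singleton _
    have h3 : {ω | (fun c (s : Fin (t + 1)) => X (c, (s : ℕ)) ω) = x}
        = ⋂ p ∈ (Finset.univ : Finset (C × Fin (t + 1))),
          X (p.1, (p.2 : ℕ)) ⁻¹' {x p.1 p.2} := by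
      ext ω
      simp [funext_iff]
    rw [h3]
    refine h2.trans ((Finset.prod_congr rfl fun p _ => hunif _ _).trans ?_)
    simp
  have hsub : {ω | (fun c (s : Fin (t + 1)) => X (c, (s : ℕ)) ω) ∈ S}
      ⊆ ⋃ x ∈ S, {ω | (fun c (s : Fin (t + 1)) => X (c, (s : ℕ)) ω) = x} := by
    intro ω hω
    simpa using hω
  refine (measure_mono hsub).trans ((measure_biUnion_finset_le _ _).trans_eq ?_)
  have hq : (0 : ℝ) < Fintype.card F := by exact_mod_cast Fintype.card_pos
  rw [Finset.sum_congr rfl fun x _ => h1 x, Finset.sum_const, nsmul_eq_mul,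
    ENNReal.ofReal_div_of_pos (pow_pos hq _), ENNReal.ofReal_pow hq.le, ENNReal.ofReal_natCast,
    ENNReal.ofReal_natCast, div_eq_mul_inv, ENNReal.inv_pow]

-- The common core of all bounds. The ideals `I` and the number `Q` are left open so that both
-- powers of `X` and the zero ideal can be used.
open Classical in
theorem measure_lt_networkTime_le [Fintype E] (N : Network V E) (R : Finset V) (D : Set N.AdjPair)
    (hD : N.Admissible D) (X : N.Coef m × ℕ → Ω → F) (hindep : iIndepFun X μ)
    (hunif : ∀ j a, μ {ω | X j ω = a} = (Fintype.card F : ℝ≥0∞)⁻¹)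
    (test : (N.Coef m → F⟦X⟧) → ℕ → V → Prop) (t : ℕ)
    (htest : ∀ r κ κ', nodeMatrix N κ r = nodeMatrix N κ' r → test κ t r → test κ' t r)
    (I : ℕ → Ideal F⟦X⟧) (hI : Antitone I) (Q : ℕ) (hQ : 0 < Q) (hd : R.card ≤ Q)
    (hY : ∀ n (c : N.Coef m) a₀ a, a ∉ I n →
      (Finset.univ.filter fun b => a₀ + a * truncKernel N D t c b ∈ I (n + 1)).card * Q
        ≤ Fintype.card (Fin (t + 1) → F))
    (B : V → Matrix E (Fin m) F⟦X⟧)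
    (h0 : ∀ r ∈ R, ∃ κ, (edmondsMatrix N (B r) κ).det ∉ I 0)
    (hpass : ∀ r ∈ R, ∀ κ : N.Coef m → F⟦X⟧, (∀ p ∈ D, constantCoeff (κ (Sum.inl p)) = 0) →
      (edmondsMatrix N (B r) κ).det ∉ I (N.numRandomLinks m) → test κ t r) :
    μ {ω | (t : ℕ∞) < networkTime N R D test (fun j => X j ω)}
      ≤ ENNReal.ofReal (1 - (1 - (R.card : ℝ) / Q) ^ N.numRandomLinks m) := by
  set η := N.numRandomLinks m
  have hfreq := pow_mul_card_le_card_notMem N.link (truncKernel N D t (m := m) (F := F)) R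
    (fun r κ => (edmondsMatrix N (B r) κ).det)
    (fun r _ => linkAffine_det_edmondsMatrix N (B r)) I hI Q hY h0
  set G := Finset.univ.filter fun x : N.Coef m → Fin (t + 1) → F =>
    ∀ r ∈ R, (edmondsMatrix N (B r) fun c => truncKernel N D t c (x c)).det
      ∉ I (Set.range N.link).ncard with hG
  have hsub : {ω | (t : ℕ∞) < networkTime N R D test (fun j => X j ω)}
      ⊆ {ω | (fun c (s : Fin (t + 1)) => X (c, (s : ℕ)) ω) ∈ Gᶜ} := by
    intro ω hω
    refine Finset.mem_compl.mpr fun hmem => ?_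
    change (t : ℕ∞) < networkTime N R D test (fun j => X j ω) at hω
    refine not_le_of_gt hω (Finset.sup_le fun r hr => ?_)
    refine firstDecodingTime_le_of_test_truncKernel N R D test _ hD r hr t (htest r) ?_
    exact hpass r hr _ (fun p hp => constantCoeff_truncKernel N D t p hp _)
      ((Finset.mem_filter.mp hmem).2 r hr)
  refine (measure_mono hsub).trans ((measure_coeffs_mem_le X hindep hunif t Gᶜ).trans
    (ENNReal.ofReal_le_ofReal ?_))
  have hcard : Fintype.card (N.Coef m → Fin (t + 1) → F)
      = Fintype.card F ^ (Fintype.card (N.Coef m) * (t + 1)) := by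
    rw [Fintype.card_fun, Fintype.card_fun, Fintype.card_fin, ← pow_mul, mul_comm]
  have hGle := Finset.card_le_univ G
  rw [Finset.card_compl, Nat.cast_sub hGle, hcard]
  have key : Fintype.card F ^ (Fintype.card (N.Coef m) * (t + 1)) * (Q - R.card) ^ η
      ≤ G.card * Q ^ η := by
    rw [← hcard]
    convert hfreq using 2
    · congr!
    · rfl
    · rw [hG]; congr!
    · rfl
  push_cast
  have hT : (0 : ℝ) < (Fintype.card F : ℝ) ^ (Fintype.card (N.Coef m) * (t + 1)) := by
    have : (0 : ℝ) < Fintype.card F := by exact_mod_cast Fintype.card_pos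
    positivity
  have hQ' : (0 : ℝ) < Q := by exact_mod_cast hQ
  have key' : (Fintype.card F : ℝ) ^ (Fintype.card (N.Coef m) * (t + 1)) * ((Q : ℝ) - R.card) ^ η
      ≤ G.card * (Q : ℝ) ^ η := by
    rw [← Nat.cast_sub hd]
    exact_mod_cast key
  rw [sub_div, div_self hT.ne', one_sub_div hQ'.ne', div_pow]
  refine sub_le_sub_left ?_ 1
  rw [div_le_div_iff₀ (by positivity) hT]
  linarith

end Probability

/-! ### Solving for the time -/

section Bounds

theorem pos_logTerm_base {η : ℕ} (hη : 0 < η) {ε : ℝ} (h0 : 0 < ε) (h1 : ε < 1) :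
    0 < 1 - (1 - ε) ^ (1 / (η : ℝ)) := by
  have : (0 : ℝ) < 1 / η := by positivity
  have := Real.rpow_lt_one (by linarith : 0 ≤ 1 - ε) (by linarith) this
  linarith

/-- With `y = 1 - (1 - ε) ^ (1 / η)`, the hypothesis says `d / q ^ T ≤ y`, and `(1 - y) ^ η = 1 -
ε`. Since `y < 1`, also `d ≤ q ^ T`. -/
theorem one_sub_pow_le_of_logTerm_le {q d η T : ℕ} (hq : 1 < q) (hd : 0 < d) (hη : 0 < η) {ε : ℝ}
    (h0 : 0 < ε) (h1 : ε < 1) (h : logTerm q d η ε ≤ T) :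
    d ≤ q ^ T ∧ 1 - (1 - (d : ℝ) / ((q ^ T : ℕ) : ℝ)) ^ η ≤ ε ∧
      (logTerm q d η ε < T → 1 - (1 - (d : ℝ) / ((q ^ T : ℕ) : ℝ)) ^ η < ε) := by
  set y := 1 - (1 - ε) ^ (1 / (η : ℝ)) with hy
  have hy0 : 0 < y := pos_logTerm_base hη h0 h1
  have hx0 : 0 < (1 - ε) ^ (1 / (η : ℝ)) := Real.rpow_pos_of_pos (by linarith) _
  have hy1 : y < 1 := by linarith
  have hq' : (1 : ℝ) < q := by exact_mod_cast hq
  have hd' : (0 : ℝ) < d := by exact_mod_cast hd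
  have hη' : (η : ℝ) ≠ 0 := by exact_mod_cast hη.ne'
  have hqT : (0 : ℝ) < (q : ℝ) ^ T := by positivity
  have hlog : logTerm q d η ε = Real.logb q (d / y) :=
    (Real.logb_div hd'.ne' hy0.ne').symm
  have hpow : ((1 - ε) ^ (1 / (η : ℝ))) ^ η = 1 - ε := by
    rw [← Real.rpow_natCast, ← Real.rpow_mul (by linarith), one_div, inv_mul_cancel₀ hη',
      Real.rpow_one]
  have hle : (d : ℝ) / (q : ℝ) ^ T ≤ y := by
    rw [hlog, Real.logb_le_iff_le_rpow hq' (by positivity), Real.rpow_natCast,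
      div_le_iff₀ hy0] at h
    rw [div_le_iff₀ hqT]
    linarith
  rw [Nat.cast_pow]
  refine ⟨?_, ?_, fun hlt => ?_⟩
  · have : (d : ℝ) ≤ (q : ℝ) ^ T := by
      have := hle.trans hy1.le
      rwa [div_le_one hqT] at this
    exact_mod_cast this
  · have := pow_le_pow_left₀ hx0.le (by linarith : _ ≤ 1 - (d : ℝ) / (q : ℝ) ^ T) η
    linarith
  · have hlt' : (d : ℝ) / (q : ℝ) ^ T < y := by
      rw [hlog, Real.logb_lt_iff_lt_rpow hq' (by positivity), Real.rpow_natCast,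
        div_lt_iff₀ hy0] at hlt
      rw [div_lt_iff₀ hqT]
      linarith
    have := pow_lt_pow_left₀ (by linarith : _ < 1 - (d : ℝ) / (q : ℝ) ^ T) hx0.le hη.ne'
    linarith

theorem exists_one_sub_pow_lt {q : ℕ} (hq : 1 < q) (d η : ℕ) {ε : ℝ} (h0 : 0 < ε) :
    ∃ l : ℕ, d ≤ q ^ l ∧ 1 - (1 - (d : ℝ) / ((q ^ l : ℕ) : ℝ)) ^ η < ε := by
  have h1 : Filter.Tendsto (fun l : ℕ => q ^ l) Filter.atTop Filter.atTop :=
    tendsto_pow_atTop_atTop_of_one_lt hq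
  have h2 : Filter.Tendsto (fun l : ℕ => 1 - (1 - (d : ℝ) / ((q ^ l : ℕ) : ℝ)) ^ η) Filter.atTop
      (nhds (1 - (1 - 0) ^ η)) :=
    (((tendsto_natCast_atTop_atTop.comp h1).const_div_atTop (d : ℝ)).const_sub 1 |>.pow η).const_sub
      1
  rw [sub_zero, one_pow, sub_self] at h2
  exact ((h1.eventually_ge_atTop d).and (h2.eventually_lt_const h0)).exists

end Bounds

/-! ### Decodability in terms of the Edmonds determinant -/

section Decodability

variable {V E F : Type*} {m : ℕ} [Fintype E] [Field F]

theorem toeplitzTest_congr (N : Network V E) (κ κ' : N.Coef m → F⟦X⟧) (t : ℕ) (r : V)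
    (h : nodeMatrix N κ r = nodeMatrix N κ' r) (ht : toeplitzTest N κ t r) :
    toeplitzTest N κ' t r := by
  have h1 : ∀ n, toeplitz N κ r n = toeplitz N κ' r n := by
    intro n
    unfold toeplitz
    rw [h]
  unfold toeplitzTest at ht ⊢
  rwa [← h1, ← h1]

theorem fullRankTest_congr (N : Network V E) (κ κ' : N.Coef m → F⟦X⟧) (t : ℕ) (r : V)
    (h : nodeMatrix N κ r = nodeMatrix N κ' r) (ht : fullRankTest N κ t r) :
    fullRankTest N κ' t r := by
  unfold fullRankTest at ht ⊢
  rwa [← h]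

open Classical in
theorem fullRankTest_of_det_edmondsMatrix_ne_zero (N : Network V E) (D : Set N.AdjPair)
    (hD : N.Admissible D) (κ : N.Coef m → F⟦X⟧)
    (hκ : ∀ p ∈ D, constantCoeff (κ (Sum.inl p)) = 0) (t : ℕ) (r : V)
    (B : Matrix E (Fin m) F⟦X⟧) (hB : ∀ e i, N.head e ≠ r → B e i = 0)
    (h : (edmondsMatrix N B κ).det ≠ 0) : fullRankTest N κ t r := by
  obtain ⟨a, ha⟩ := exists_det_edmondsMatrix_eq N D hD κ hκ r B hB
  rw [ha] at h
  convert fullRankTest_of_det_ne_zero N κ t r _ (right_ne_zero_of_mul h)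

open Classical in
theorem toeplitzTest_of_not_X_pow_dvd_det_edmondsMatrix (N : Network V E) (D : Set N.AdjPair)
    (hD : N.Admissible D) (κ : N.Coef m → F⟦X⟧)
    (hκ : ∀ p ∈ D, constantCoeff (κ (Sum.inl p)) = 0) (t : ℕ) (r : V)
    (B : Matrix E (Fin m) F⟦X⟧) (hB : ∀ e i, N.head e ≠ r → B e i = 0)
    (h : ¬ X ^ (t + 1) ∣ (edmondsMatrix N B κ).det) : toeplitzTest N κ t r := by
  obtain ⟨a, ha⟩ := exists_det_edmondsMatrix_eq N D hD κ hκ r B hB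
  rw [ha] at h
  exact toeplitzTest_of_not_X_pow_dvd_det N κ t r _ fun hd => h (hd.mul_left a)

open Classical in
theorem exists_decoding_matrices (N : Network V E) (R : Finset V) (hs : N.source ∉ R)
    (hcut : ∀ r ∈ R, N.MinCutAtLeast m r) :
    ∃ B : V → Matrix E (Fin m) F⟦X⟧, ∀ r ∈ R,
      (∀ e i, N.head e ≠ r → B r e i = 0) ∧ ∃ κ, (edmondsMatrix N (B r) κ).det ≠ 0 := by
  have h : ∀ r ∈ R, ∃ B : Matrix E (Fin m) F⟦X⟧,
      (∀ e i, N.head e ≠ r → B e i = 0) ∧ ∃ κ, (edmondsMatrix N B κ).det ≠ 0 := by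
    intro r hr
    obtain ⟨B, κ, h1, h2⟩ := exists_det_edmondsMatrix_ne_zero (F := F) N r
      (fun h => hs (h ▸ hr)) (hcut r hr)
    exact ⟨B, h1, κ, h2⟩
  choose! B hB using h
  exact ⟨B, hB⟩

theorem exists_not_X_pow_dvd {f : F⟦X⟧} (hf : f ≠ 0) : ∃ n : ℕ, ¬ X ^ n ∣ f := by
  by_contra! h
  refine hf (PowerSeries.ext fun n => ?_)
  rw [map_zero]
  exact X_pow_dvd_iff.mp (h (n + 1)) n n.lt_succ_self

omit [Field F] in
theorem numRandomLinks_pos (N : Network V E) (hm : 0 < m) (r : V) (hr : r ≠ N.source)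
    (hcut : N.MinCutAtLeast m r) : 0 < N.numRandomLinks m := by
  have h := hcut {N.source} rfl hr
  obtain ⟨e, he, -⟩ := (Set.ncard_pos (Set.toFinite _)).mp (hm.trans_le h)
  exact (Set.ncard_pos (Set.toFinite _)).mpr ⟨e, Sum.inr (⟨e, he⟩, ⟨0, hm⟩), rfl⟩

end Decodability

/-! ### Tail bounds for the network decoding time -/

section Main

variable {V E F Ω : Type*} {m : ℕ} [Fintype E] [Field F] [Fintype F] [MeasurableSpace F]
  [MeasurableSingletonClass F] [MeasurableSpace Ω] {μ : Measure Ω}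

/-- The probability that decoding takes long becomes arbitrarily small, for both tests. -/
theorem exists_measure_lt_networkTime_lt (N : Network V E) (R : Finset V) (hR : R.Nonempty)
    (hs : N.source ∉ R) (hm : 0 < m) (hcut : ∀ r ∈ R, N.MinCutAtLeast m r)
    (D : Set N.AdjPair) (hD : N.Admissible D) (X : N.Coef m × ℕ → Ω → F) (hindep : iIndepFun X μ)
    (hunif : ∀ j a, μ {ω | X j ω = a} = (Fintype.card F : ℝ≥0∞)⁻¹)
    (test : (N.Coef m → F⟦X⟧) → ℕ → V → Prop)
    (htest : test = toeplitzTest N ∨ test = fullRankTest N) {ε : ℝ} (hε : 0 < ε) :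
    ∃ t : ℕ, μ {ω | (t : ℕ∞) < networkTime N R D test (fun j => X j ω)} < ENNReal.ofReal ε := by
  classical
  obtain ⟨B, hB⟩ := exists_decoding_matrices (F := F) N R hs hcut
  obtain ⟨r₀, hr₀⟩ := hR
  have hη := numRandomLinks_pos N hm r₀ (fun h => hs (h ▸ hr₀)) (hcut r₀ hr₀)
  set η := N.numRandomLinks m with hηdef
  obtain ⟨l, hl, hlε⟩ := exists_one_sub_pow_lt (Fintype.one_lt_card (α := F)) R.card η hε
  have hn : ∀ r ∈ R, ∃ n : ℕ, ∃ κ, ¬ (PowerSeries.X : F⟦X⟧) ^ n ∣ (edmondsMatrix N (B r) κ).det := by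
    intro r hr
    obtain ⟨κ, hκ⟩ := (hB r hr).2
    obtain ⟨n, hn⟩ := exists_not_X_pow_dvd hκ
    exact ⟨n, κ, hn⟩
  choose! n hn using hn
  set n₀ := R.sup n
  -- Starting from `X ^ (n₀ + 1)` and losing `l` powers on each of `η` links ends at `X ^ (t + 1)`,
  -- exactly what the Toeplitz test at time `t` needs.
  set t := n₀ + η * l with ht
  have hlt : l ≤ t := (Nat.le_mul_of_pos_left l hη).trans (Nat.le_add_left _ _)
  refine ⟨t, (measure_lt_networkTime_le N R D hD X hindep hunif test t ?_
    (fun i => Ideal.span {(PowerSeries.X : F⟦X⟧) ^ (n₀ + 1 + i * l)}) ?_ (Fintype.card F ^ l)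
    (pow_pos Fintype.card_pos l) hl ?_ B ?_ ?_).trans_lt
    ((ENNReal.ofReal_lt_ofReal_iff hε).mpr hlε)⟩
  · intro r κ κ' h
    rcases htest with rfl | rfl
    · exact toeplitzTest_congr N κ κ' t r h
    · exact fullRankTest_congr N κ κ' t r h
  · intro i j hij
    refine Ideal.span_singleton_le_span_singleton.mpr (pow_dvd_pow _ ?_)
    have := Nat.mul_le_mul_right l hij
    omega
  · intro i c a₀ a ha
    have := card_filter_mem_span_X_pow_mul_le N D t l _ hlt c a₀ a ha
    rwa [add_assoc _ _ l, ← Nat.succ_mul] at this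
  · intro r hr
    obtain ⟨κ, hκ⟩ := hn r hr
    refine ⟨κ, fun h => hκ ?_⟩
    rw [Ideal.mem_span_singleton] at h
    have : n r ≤ n₀ := Finset.le_sup hr
    exact dvd_trans (pow_dvd_pow _ (by omega)) h
  · intro r hr κ hκ h
    rw [Ideal.mem_span_singleton, ← hηdef, add_right_comm, ← ht] at h
    rcases htest with rfl | rfl
    · exact toeplitzTest_of_not_X_pow_dvd_det_edmondsMatrix N D hD κ hκ t r (B r) (hB r hr).1 h
    · refine fullRankTest_of_det_edmondsMatrix_ne_zero N D hD κ hκ t r (B r) (hB r hr).1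
        fun h0 => h ?_
      rw [h0]
      exact dvd_zero _

open Classical in
/-- The explicit bound, when a kernel is drawn from a set of size `q ^ T` at least. -/
theorem measure_lt_networkTime_fullRankTest_le (N : Network V E) (R : Finset V) (hR : R.Nonempty)
    (hs : N.source ∉ R) (hm : 0 < m) (hcut : ∀ r ∈ R, N.MinCutAtLeast m r)
    (D : Set N.AdjPair) (hD : N.Admissible D) (X : N.Coef m × ℕ → Ω → F) (hindep : iIndepFun X μ)
    (hunif : ∀ j a, μ {ω | X j ω = a} = (Fintype.card F : ℝ≥0∞)⁻¹) (t T : ℕ)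
    (hY : ∀ (c : N.Coef m) (a₀ a : F⟦X⟧), a ∉ (⊥ : Ideal F⟦X⟧) →
      (Finset.univ.filter fun b => a₀ + a * truncKernel N D t c b ∈ (⊥ : Ideal F⟦X⟧)).card
        * Fintype.card F ^ T ≤ Fintype.card (Fin (t + 1) → F))
    {ε : ℝ} (h0 : 0 < ε) (h1 : ε < 1)
    (hT : logTerm (Fintype.card F) R.card (N.numRandomLinks m) ε ≤ T) :
    μ {ω | (t : ℕ∞) < networkTime N R D (fullRankTest N) (fun j => X j ω)} ≤ ENNReal.ofReal ε ∧
      (logTerm (Fintype.card F) R.card (N.numRandomLinks m) ε < T →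
        μ {ω | (t : ℕ∞) < networkTime N R D (fullRankTest N) (fun j => X j ω)}
          < ENNReal.ofReal ε) := by
  obtain ⟨B, hB⟩ := exists_decoding_matrices (F := F) N R hs hcut
  have hη : 0 < N.numRandomLinks m := by
    obtain ⟨r₀, hr₀⟩ := hR
    exact numRandomLinks_pos N hm r₀ (fun h => hs (h ▸ hr₀)) (hcut r₀ hr₀)
  obtain ⟨hd, hle, hlt⟩ := one_sub_pow_le_of_logTerm_le (Fintype.one_lt_card (α := F))
    (Finset.card_pos.mpr hR) hη h0 h1 hT
  have key := measure_lt_networkTime_le N R D hD X hindep hunif (fullRankTest N) t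
    (fun r κ κ' => fullRankTest_congr N κ κ' t r) (fun _ => ⊥) antitone_const
    (Fintype.card F ^ T) (pow_pos Fintype.card_pos T) hd (fun _ => hY) B
    (fun r hr => (hB r hr).2)
    (fun r hr κ hκ h => fullRankTest_of_det_edmondsMatrix_ne_zero N D hD κ hκ t r (B r)
      (hB r hr).1 h)
  exact ⟨key.trans (ENNReal.ofReal_le_ofReal hle), fun h =>
    key.trans_lt ((ENNReal.ofReal_lt_ofReal_iff h0).mpr (hlt h))⟩

end Main

theorem lt_of_ceil_le_of_forall_ne {x : ℝ} {k : ℤ} (h : ⌈x⌉ ≤ k) (hne : ∀ n : ℤ, x ≠ n) :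
    x < k :=
  lt_of_le_of_ne (Int.ceil_le.mp h) (hne k)

end ARCNC

theorem corollary1 {V E F Ω : Type*} [Finite V] [Fintype E] [Field F] [Fintype F]
    [MeasurableSpace F] [MeasurableSingletonClass F]
    (N : ARCNC.Network V E) (R : Finset V) (hR : R.Nonempty) (hs : N.source ∉ R)
    (m : ℕ) (hm : 0 < m) (hcut : ∀ r ∈ R, N.MinCutAtLeast m r)
    (D : Set N.AdjPair) (hD : N.Admissible D)
    [MeasurableSpace Ω] (μ : Measure Ω) [IsProbabilityMeasure μ]
    (X : N.Coef m × ℕ → Ω → F) (hX : ∀ j, Measurable (X j)) (hindep : iIndepFun X μ)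
    (hunif : ∀ j a, μ {ω | X j ω = a} = (Fintype.card F : ℝ≥0∞)⁻¹) :
    -- for both forms of the decodability test
    (∀ test : (N.Coef m → PowerSeries F) → ℕ → V → Prop,
      test = ARCNC.toeplitzTest N ∨ test = ARCNC.fullRankTest N →
      (∀ ε : ℝ, 0 < ε → ε < 1 → ∃ T₀ : ℕ, 0 < T₀ ∧ ∀ t : ℕ, T₀ ≤ t →
        μ {ω | (t : ℕ∞) < ARCNC.networkTime N R D test (fun j => X j ω)} < ENNReal.ofReal ε) ∧
      (∀ᵐ ω ∂μ, ARCNC.networkTime N R D test (fun j => X j ω) < ⊤ ∧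
        ∃ t₀ : ℕ, ∀ t : ℕ, t₀ ≤ t →
          (ARCNC.run N R D test (fun j => X j ω) t).kernel =
            (ARCNC.run N R D test (fun j => X j ω) t₀).kernel)) ∧
    -- the explicit time when no coefficient is delayed, as in an acyclic network
    (D = ∅ → ∀ ε : ℝ, 0 < ε → ε < 1 → ∀ t : ℕ,
      ARCNC.explicitTime (Fintype.card F) R.card (N.numRandomLinks m) ε ≤ t →
        μ {ω | (t : ℕ∞) < ARCNC.networkTime N R D (ARCNC.fullRankTest N) (fun j => X j ω)}
          ≤ ENNReal.ofReal ε ∧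
        (ARCNC.explicitTime (Fintype.card F) R.card (N.numRandomLinks m) ε < t ∨
          (∀ n : ℤ, ARCNC.logTerm (Fintype.card F) R.card (N.numRandomLinks m) ε ≠ n) →
        μ {ω | (t : ℕ∞) < ARCNC.networkTime N R D (ARCNC.fullRankTest N) (fun j => X j ω)}
          < ENNReal.ofReal ε)) ∧
    -- the explicit time in general
    (∀ ε : ℝ, 0 < ε → ε < 1 → ∀ t : ℕ,
      ARCNC.explicitTime (Fintype.card F) R.card (N.numRandomLinks m) ε + 1 ≤ t →
        μ {ω | (t : ℕ∞) < ARCNC.networkTime N R D (ARCNC.fullRankTest N) (fun j => X j ω)}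
          ≤ ENNReal.ofReal ε ∧
        (ARCNC.explicitTime (Fintype.card F) R.card (N.numRandomLinks m) ε + 1 < t ∨
          (∀ n : ℤ, ARCNC.logTerm (Fintype.card F) R.card (N.numRandomLinks m) ε ≠ n) →
        μ {ω | (t : ℕ∞) < ARCNC.networkTime N R D (ARCNC.fullRankTest N) (fun j => X j ω)}
          < ENNReal.ofReal ε)) := by
  classical
  refine ⟨fun test htest => ?_, fun hD0 ε h0 h1 t ht => ?_, fun ε h0 h1 t ht => ?_⟩
  · have key : ∀ ε : ℝ, 0 < ε → ∃ T₀ : ℕ, 0 < T₀ ∧ ∀ t : ℕ, T₀ ≤ t →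
        μ {ω | (t : ℕ∞) < ARCNC.networkTime N R D test (fun j => X j ω)}
          < ENNReal.ofReal ε := by
      intro ε hε
      obtain ⟨T, hT⟩ := ARCNC.exists_measure_lt_networkTime_lt N R hR hs hm hcut D hD X hindep
        hunif test htest hε
      -- The events shrink as time grows, so one good time suffices; the shift by one only secures
      -- positivity.
      refine ⟨T + 1, T.succ_pos, fun t ht => (measure_mono fun ω hω => ?_).trans_lt hT⟩
      have hTt : (T : ℕ∞) ≤ t := by exact_mod_cast T.le_succ.trans ht
      exact hTt.trans_lt (show (t : ℕ∞) < _ from hω)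
    refine ⟨fun ε hε _ => key ε hε, ?_⟩
    have hfin : ∀ᵐ ω ∂μ, ARCNC.networkTime N R D test (fun j => X j ω) < ⊤ := by
      rw [ae_iff]
      refine le_antisymm (ENNReal.le_of_forall_pos_le_add fun δ hδ _ => ?_) zero_le
      obtain ⟨T, -, hT⟩ := key δ hδ
      rw [zero_add, ← ENNReal.ofReal_coe_nnreal]
      refine (measure_mono fun ω hω => ?_).trans (hT T le_rfl).le
      have htop : ARCNC.networkTime N R D test (fun j => X j ω) = ⊤ := not_lt_top_iff.mp hω
      change (T : ℕ∞) < ARCNC.networkTime N R D test (fun j => X j ω)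
      rw [htop]
      exact ENat.natCast_lt_top T
    filter_upwards [hfin] with ω hω
    exact ⟨hω, ARCNC.exists_kernel_eq_of_networkTime_lt_top N R D test _ hω⟩
  · subst hD0
    rw [ARCNC.explicitTime, sub_le_iff_le_add] at ht
    -- At time `t` there are `t + 1` free coefficients per kernel, and `⌈x⌉ - 1 ≤ t` means `x ≤ t +
    -- 1`.
    obtain ⟨hle, hlt⟩ := ARCNC.measure_lt_networkTime_fullRankTest_le N R hR hs hm hcut ∅ hD X
      hindep hunif t (t + 1) (ARCNC.card_filter_mem_bot_mul_le_of_eq_empty N t) h0 h1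
      (by exact_mod_cast Int.ceil_le.mp ht)
    refine ⟨hle, fun h => hlt ?_⟩
    rcases h with h | h
    · rw [ARCNC.explicitTime, sub_lt_iff_lt_add, Int.lt_add_one_iff, Int.ceil_le] at h
      push_cast at h ⊢
      linarith
    · exact_mod_cast ARCNC.lt_of_ceil_le_of_forall_ne ht h
  · rw [ARCNC.explicitTime, sub_add_cancel] at ht
    -- A delayed kernel has only `t` free coefficients, hence the time is later by one.
    obtain ⟨hle, hlt⟩ := ARCNC.measure_lt_networkTime_fullRankTest_le N R hR hs hm hcut D hD X
      hindep hunif t t (ARCNC.card_filter_mem_bot_mul_le N D t) h0 h1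
      (by exact_mod_cast Int.ceil_le.mp ht)
    refine ⟨hle, fun h => hlt ?_⟩
    rcases h with h | h
    · rw [ARCNC.explicitTime, sub_add_cancel, Int.ceil_lt_iff] at h
      push_cast at h
      linarith
    · exact_mod_cast ARCNC.lt_of_ceil_le_of_forall_ne ht h
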